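/- Let $\mathcal B\subset\mathcal A$ be a unital inclusion of unital C$^*$-algebras with a positive conditional expectation $E\colon\mathcal A\to\mathcal B$. Let $\mathcal B\langle\mathcal X\rangle$ be the $*$-algebra freely generated by $\mathcal B$ and a self-adjoint symbol $\mathcal X$, let $\mathcal B\langle\mathcal X\rangle_0$ be the set of polynomials in it without free term, and for $x\in\mathcal A$ let $\mathcal B\langle x\rangle_0=\{f(x):f\in\mathcal B\langle\mathcal X\rangle_0\}$. The distribution of $x=x^*\in\mathcal A$ is the map $\mu_x\colon\mathcal B\langle\mathcal X\rangle\to\mathcal B$, $\mu_x(f)=E(f(x))$. A family $(x_i)_{i\in I}$ of self-adjoint elements, $I$ totally ordered, is monotone independent over $\mathcal B$ if $$E(A_1\cdots A_n)=E\bigl(A_1\cdots A_{j-1}\,E(A_j)\,A_{j+1}\cdots A_n\bigr)$$ whenever $A_l\in\mathcal B\langle x_{\epsilon(l)}\rangle_0$, $\epsilon(l)\ne\epsilon(l+1)$ for all $l$, and $\epsilon(j-1)<\epsilon(j)>\epsilon(j+1)$ (for $j=1$ or $j=n$ only the inequality with the existing neighbour is required). For a linear map $\mu\colon\mathcal B\langle\mathcal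 X\rangle\to\mathcal B$, apply $\mu$ entrywise to matrices and write $\tilde\mu$ for the resulting map. For $b\in M_m(\mathcal B)$ put $$M_\mu(b)=\sum_{k\ge0}\tilde\mu\bigl([\mathcal X\cdot b]^k\bigr),\qquad \mathfrak H_\mu(b)=b\cdot M_\mu(b),$$ where $\mathcal X$ multiplies matrices entrywise. Let $\Sigma^0_{\mathcal B}$ be the set of positive conditional expectations $\mu\colon\mathcal B\langle\mathcal X\rangle\to\mathcal B$ for which there is $M>0$ with $\|\tilde\mu(\mathcal X b_1\mathcal X b_2\cdots\mathcal X b_n\mathcal X)\|\le M^{n+1}\|b_1\|\cdots\|b_n\|$ for all $m\geq 1$, $n\ge0$ and $b_1,\dots,b_n\in M_m(\mathcal B)$. Let $\mathrm{Nilp}(\mathcal B,m)$ be the set of $T\in M_m(\mathcal B)$ that are nilpotent as matrices over the tensor algebra of the complex vector space $\mathcal B$. Let $x_1,x_2,\dots\in\mathcal A$ be self-adjoint, centered ($E(x_i)=0$), identically distributed and monotone independent over $\mathcal B$. Then there is $\mathfrak a\in\Sigma^0_{\mathcal B}$ (the operator-valued arcsine law) such that the distributions of $(x_1+\dots+x_N)/\sqrt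 N$ converge to $\mathfrak a$ weakly, that is, in norm on each $f\in\mathcal B\langle\mathcal X\rangle$, and $\mathfrak a$ is stable under monotone convolution. Precisely, let $\mathfrak a_2(f(\mathcal X))=\mathfrak a(f(\sqrt2\,\mathcal X))$ be the dilation of $\mathfrak a$ by $\sqrt2$. Then $$\mathfrak H_{\mathfrak a}\circ\mathfrak H_{\mathfrak a}=\mathfrak H_{\mathfrak a_2}$$ in the following two senses, with convergence of all the series involved: 1. for every $m$, $\mathfrak H_{\mathfrak a}$ maps $\mathrm{Nilp}(\mathcal B,m)$ into itself and the identity holds there; 2. there is $r>0$ such that for every $m$ the identity holds at every $b\in M_m(\mathcal B)$ with $\|b\|<r$. Moreover, if $y,z$ are self-adjoint elements of a $\mathcal B$-valued C$^*$-probability space (a unital C$^*$-inclusion $\mathcal B\subset\mathcal A'$ with a positive conditional expectation onto $\mathcal B$), both with distribution $\mathfrak a$ and with $(y,z)$ monotone independent over $\mathcal B$, then $y+z$ has distribution $\mathfrak a_2$. -/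

import Mathlib

open Filter Topology

noncomputable section

/-! ### The algebra `B⟨𝒳⟩` of noncommutative polynomials with coefficients in `B` -/

/-- The relations making the generators indexed by `B` a unital copy of the algebra `B`;
the generator `none` is the indeterminate `𝒳`. -/
inductive NCPoly.Rel (B : Type*) [Ring B] [Algebra ℂ B] :
    FreeAlgebra ℂ (Option B) → FreeAlgebra ℂ (Option B) → Prop
  | add (a b : B) : NCPoly.Rel B (FreeAlgebra.ι ℂ (some (a + b)))
      (FreeAlgebra.ι ℂ (some a) + FreeAlgebra.ι ℂ (some b))
  | mul (a b : B) : NCPoly.Rel B (FreeAlgebra.ι ℂ (some (a * b)))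
      (FreeAlgebra.ι ℂ (some a) * FreeAlgebra.ι ℂ (some b))
  | scalar (c : ℂ) : NCPoly.Rel B (FreeAlgebra.ι ℂ (some (algebraMap ℂ B c)))
      (algebraMap ℂ (FreeAlgebra ℂ (Option B)) c)

/-- `B⟨𝒳⟩`: the unital complex algebra freely generated by the algebra `B` and a symbol `𝒳`. -/
def NCPoly (B : Type*) [Ring B] [Algebra ℂ B] : Type _ := RingQuot (NCPoly.Rel B)

namespace NCPoly

instance instRing (B : Type*) [Ring B] [Algebra ℂ B] : Ring (NCPoly B) :=
  inferInstanceAs (Ring (RingQuot (NCPoly.Rel B)))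

instance instAlgebra (B : Type*) [Ring B] [Algebra ℂ B] : Algebra ℂ (NCPoly B) :=
  inferInstanceAs (Algebra ℂ (RingQuot (NCPoly.Rel B)))

/-- The quotient map from the free algebra. -/
def mk (B : Type*) [Ring B] [Algebra ℂ B] : FreeAlgebra ℂ (Option B) →ₐ[ℂ] NCPoly B :=
  RingQuot.mkAlgHom ℂ (NCPoly.Rel B)

/-- The indeterminate `𝒳`. -/
def X (B : Type*) [Ring B] [Algebra ℂ B] : NCPoly B := mk B (FreeAlgebra.ι ℂ none)

/-- The inclusion of the coefficient algebra `B` in `B⟨𝒳⟩`. -/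
def C (B : Type*) [Ring B] [Algebra ℂ B] : B →ₐ[ℂ] NCPoly B where
  toFun b := mk B (FreeAlgebra.ι ℂ (some b))
  map_one' := by
    have h := RingQuot.mkAlgHom_rel ℂ (Rel.scalar (B := B) 1)
    rw [map_one, map_one, map_one] at h
    exact h
  map_mul' a b := by
    have h := RingQuot.mkAlgHom_rel ℂ (Rel.mul a b)
    rw [map_mul] at h
    exact h
  map_zero' := by
    have h := RingQuot.mkAlgHom_rel ℂ (Rel.scalar (B := B) 0)
    rw [map_zero, map_zero, map_zero] at h
    exact h
  map_add' a b := by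
    have h := RingQuot.mkAlgHom_rel ℂ (Rel.add a b)
    rw [map_add] at h
    exact h
  commutes' c := by
    have h := RingQuot.mkAlgHom_rel ℂ (Rel.scalar (B := B) c)
    rw [AlgHom.commutes] at h
    exact h

/-- The universal property: a unital homomorphism `f` on `B` and a value `x` for `𝒳` extend
to a unital homomorphism on `B⟨𝒳⟩`, the evaluation at `x`. -/
def lift {B : Type*} [Ring B] [Algebra ℂ B] {R : Type*} [Ring R] [Algebra ℂ R]
    (f : B →ₐ[ℂ] R) (x : R) : NCPoly B →ₐ[ℂ] R :=
  RingQuot.liftAlgHom ℂ ⟨FreeAlgebra.lift ℂ (fun o : Option B => o.elim x f), by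
    intro p q h
    cases h <;> simp⟩

theorem lift_X {B : Type*} [Ring B] [Algebra ℂ B] {R : Type*} [Ring R] [Algebra ℂ R]
    (f : B →ₐ[ℂ] R) (x : R) : lift f x (X B) = x :=
  (RingQuot.liftAlgHom_mkAlgHom_apply ℂ _ _ _).trans (by simp)

theorem lift_C {B : Type*} [Ring B] [Algebra ℂ B] {R : Type*} [Ring R] [Algebra ℂ R]
    (f : B →ₐ[ℂ] R) (x : R) (b : B) : lift f x (C B b) = f b :=
  (RingQuot.liftAlgHom_mkAlgHom_apply ℂ _ _ _).trans (by simp)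

/-- Induction on noncommutative polynomials. -/
theorem induction {B : Type*} [Ring B] [Algebra ℂ B] {motive : NCPoly B → Prop}
    (hC : ∀ b, motive (C B b)) (hX : motive (X B))
    (hadd : ∀ p q, motive p → motive q → motive (p + q))
    (hmul : ∀ p q, motive p → motive q → motive (p * q)) (p : NCPoly B) : motive p := by
  obtain ⟨q, rfl⟩ : ∃ q, mk B q = p := RingQuot.mkAlgHom_surjective ℂ (NCPoly.Rel B) p
  induction q using FreeAlgebra.induction with
  | grade0 c =>
    have h := hC (algebraMap ℂ B c)
    rwa [AlgHom.commutes] at h ⊢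
  | grade1 o =>
    cases o with
    | none => exact hX
    | some b => exact hC b
  | mul a b ha hb => rw [map_mul]; exact hmul _ _ ha hb
  | add a b ha hb => rw [map_add]; exact hadd _ _ ha hb

/-- The opposite ring of `R` with complex scalars acting through conjugation: conjugate-linear
antihomomorphisms into `R` are homomorphisms into `ConjOp R`. -/
def ConjOp (R : Type*) : Type _ := Rᵐᵒᵖ

instance instRingConjOp (R : Type*) [Ring R] : Ring (ConjOp R) := inferInstanceAs (Ring Rᵐᵒᵖ)

instance instAlgebraConjOp (R : Type*) [Ring R] [Algebra ℂ R] : Algebra ℂ (ConjOp R) :=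
  RingHom.toAlgebra' (((algebraMap ℂ Rᵐᵒᵖ).comp (starRingEnd ℂ) : ℂ →+* Rᵐᵒᵖ))
    (fun c x => Algebra.commutes (A := Rᵐᵒᵖ) (starRingEnd ℂ c) x)

/-- The involution of `B⟨𝒳⟩` as a homomorphism into `ConjOp B⟨𝒳⟩`. -/
def starHom (B : Type*) [Ring B] [StarRing B] [Algebra ℂ B] [StarModule ℂ B] :
    NCPoly B →ₐ[ℂ] ConjOp (NCPoly B) :=
  lift (R := ConjOp (NCPoly B))
    { toFun := fun b => (MulOpposite.op (C B (star b)) : (NCPoly B)ᵐᵒᵖ)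
      map_one' := by simp; rfl
      map_mul' := fun a b => by simp; rfl
      map_zero' := by simp; rfl
      map_add' := fun a b => by simp; rfl
      commutes' := fun c => by
        rw [← algebraMap_star_comm, AlgHom.commutes]; rfl }
    (MulOpposite.op (X B) : (NCPoly B)ᵐᵒᵖ)

/-- The involution of `B⟨𝒳⟩`: conjugate-linear, antimultiplicative, extending the involution of
`B`, with `𝒳` self-adjoint. -/
instance instStarRing (B : Type*) [Ring B] [StarRing B] [Algebra ℂ B] [StarModule ℂ B] :
    StarRing (NCPoly B) where
  star p := MulOpposite.unop (α := NCPoly B) (starHom B p)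
  star_mul p q := by
    change MulOpposite.unop (α := NCPoly B) (starHom B (p * q)) = _
    rw [map_mul]; rfl
  star_add p q := by
    change MulOpposite.unop (α := NCPoly B) (starHom B (p + q)) = _
    rw [map_add]; rfl
  star_involutive p := by
    change MulOpposite.unop (α := NCPoly B) (starHom B
      (MulOpposite.unop (α := NCPoly B) (starHom B p))) = p
    induction p using NCPoly.induction with
    | hC b =>
      have h : ∀ b : B, starHom B (C B b) = (MulOpposite.op (C B (star b)) : (NCPoly B)ᵐᵒᵖ) :=
        fun b => lift_C _ _ b
      rw [h, MulOpposite.unop_op, h, MulOpposite.unop_op, star_star]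
    | hX =>
      have h : starHom B (X B) = (MulOpposite.op (X B) : (NCPoly B)ᵐᵒᵖ) := lift_X _ _
      rw [h, MulOpposite.unop_op, h, MulOpposite.unop_op]
    | hadd p q hp hq =>
      have h1 : MulOpposite.unop (α := NCPoly B) (starHom B (p + q)) =
          MulOpposite.unop (α := NCPoly B) (starHom B p) +
            MulOpposite.unop (α := NCPoly B) (starHom B q) := by rw [map_add]; rfl
      rw [h1, map_add]
      exact congrArg₂ (· + ·) hp hq
    | hmul p q hp hq =>
      have h1 : MulOpposite.unop (α := NCPoly B) (starHom B (p * q)) =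
          MulOpposite.unop (α := NCPoly B) (starHom B q) *
            MulOpposite.unop (α := NCPoly B) (starHom B p) := by rw [map_mul]; rfl
      rw [h1, map_mul]
      exact congrArg₂ (· * ·) hp hq

theorem star_X (B : Type*) [Ring B] [StarRing B] [Algebra ℂ B] [StarModule ℂ B] :
    star (X B) = X B := by
  have h : starHom B (X B) = (MulOpposite.op (X B) : (NCPoly B)ᵐᵒᵖ) := lift_X _ _
  change MulOpposite.unop (α := NCPoly B) (starHom B (X B)) = _
  rw [h, MulOpposite.unop_op]

theorem star_C (B : Type*) [Ring B] [StarRing B] [Algebra ℂ B] [StarModule ℂ B] (b : B) :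
    star (C B b) = C B (star b) := by
  have h : starHom B (C B b) = (MulOpposite.op (C B (star b)) : (NCPoly B)ᵐᵒᵖ) := lift_C _ _ b
  change MulOpposite.unop (α := NCPoly B) (starHom B (C B b)) = _
  rw [h, MulOpposite.unop_op]

/-- `B⟨𝒳⟩₀`: the polynomials whose free term, i.e. the value at `𝒳 = 0`, vanishes. -/
def noFreeTerm (B : Type*) [Ring B] [Algebra ℂ B] : Set (NCPoly B) :=
  {p | lift (AlgHom.id ℂ B) 0 p = 0}

end NCPoly

/-! ### Distributions and their transforms -/

/-- `Σ_B`: the positive conditional expectations from `B⟨𝒳⟩` onto `B`. -/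
structure IsBDistribution {B : Type*} [CStarAlgebra B] [PartialOrder B] [StarOrderedRing B]
    (μ : NCPoly B →ₗ[ℂ] B) : Prop where
  map_C : ∀ b, μ (NCPoly.C B b) = b
  bimodule : ∀ b p b', μ (NCPoly.C B b * p * NCPoly.C B b') = b * μ p * b'
  pos : ∀ p, 0 ≤ μ (star p * p)

/-- Left multiplication by `𝒳` of the matrix `b` over `B`: the matrix `𝒳 · b` over `B⟨𝒳⟩`. -/
def xMul {B : Type*} [CStarAlgebra B] {m : ℕ} (b : CStarMatrix (Fin m) (Fin m) B) :
    CStarMatrix (Fin m) (Fin m) (NCPoly B) :=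
  b.map (fun c => NCPoly.X B * NCPoly.C B c)

/-- The moments of the fully matricial extension (`μ` applied entrywise) do not grow faster than
exponentially: `‖μ̃(𝒳 b₁ 𝒳 b₂ ⋯ 𝒳 bₙ 𝒳)‖ ≤ M ^ (n + 1) ‖b₁‖ ⋯ ‖bₙ‖`, with the same `M` for
matrices of all sizes; matrices over `B` carry their C⋆-norm. -/
def ExponentiallyBounded {B : Type*} [CStarAlgebra B] [PartialOrder B] [StarOrderedRing B]
    (μ : NCPoly B →ₗ[ℂ] B) : Prop :=
  ∃ M : ℝ, 0 < M ∧ ∀ (m n : ℕ) (b : Fin n → CStarMatrix (Fin m) (Fin m) B),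
    ‖(List.ofFn fun i => xMul (b i)).prod.map (fun p => μ (p * NCPoly.X B))‖ ≤
      M ^ (n + 1) * ∏ i, ‖b i‖

/-- `Σ_B⁰`: the elements of `Σ_B` whose moments do not grow faster than exponentially. -/
structure IsBDistribution₀ {B : Type*} [CStarAlgebra B] [PartialOrder B] [StarOrderedRing B]
    (μ : NCPoly B →ₗ[ℂ] B) : Prop extends IsBDistribution μ where
  expBounded : ExponentiallyBounded μ

/-- The dilation of `μ` by `c`: `f(𝒳) ↦ μ(f(c𝒳))`. -/
def dilation {B : Type*} [CStarAlgebra B] (c : ℝ) (μ : NCPoly B →ₗ[ℂ] B) : NCPoly B →ₗ[ℂ] B :=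
  μ ∘ₗ (NCPoly.lift (NCPoly.C B) ((c : ℂ) • NCPoly.X B)).toLinearMap

/-- The symmetric moment `μ̃([𝒳 · b]ᵏ)` of the fully matricial extension of `μ`. -/
def matMoment {B : Type*} [CStarAlgebra B] (μ : NCPoly B →ₗ[ℂ] B) {m : ℕ}
    (b : CStarMatrix (Fin m) (Fin m) B) (k : ℕ) : CStarMatrix (Fin m) (Fin m) B :=
  (xMul b ^ k).map μ

/-- The moment-generating series `M_μ(b) = ∑ₖ μ̃([𝒳 · b]ᵏ)` on matrices of all sizes. -/
def momentSeries {B : Type*} [CStarAlgebra B] [PartialOrder B] [StarOrderedRing B]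
    (μ : NCPoly B →ₗ[ℂ] B) {m : ℕ} (b : CStarMatrix (Fin m) (Fin m) B) :
    CStarMatrix (Fin m) (Fin m) B :=
  ∑' k, matMoment μ b k

/-- The transform `𝔥_μ(b) = b · M_μ(b)`. -/
def hTransform {B : Type*} [CStarAlgebra B] [PartialOrder B] [StarOrderedRing B]
    (μ : NCPoly B →ₗ[ℂ] B) {m : ℕ} (b : CStarMatrix (Fin m) (Fin m) B) :
    CStarMatrix (Fin m) (Fin m) B :=
  b * momentSeries μ b

/-- `Nilp(B, m)`: the matrices over `B` that are nilpotent as matrices over the tensor algebra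
of `B`. -/
def nilp (B : Type*) [CStarAlgebra B] (m : ℕ) : Set (CStarMatrix (Fin m) (Fin m) B) :=
  {T | ∃ r : ℕ, (T.map (TensorAlgebra.ι ℂ) : CStarMatrix (Fin m) (Fin m) (TensorAlgebra ℂ B)) ^ r
    = 0}

/-! ### `B`-valued C⋆-probability spaces and monotone independence -/

/-- A `B`-valued noncommutative C⋆-probability space: a unital inclusion of C⋆-algebras
(injective by `E_incl`) with a positive conditional expectation. -/
structure BProbSpace (B A : Type*) [CStarAlgebra B] [PartialOrder B] [StarOrderedRing B]
    [CStarAlgebra A] where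
  incl : B →⋆ₐ[ℂ] A
  E : A →ₗ[ℂ] B
  E_incl : ∀ b, E (incl b) = b
  E_bimodule : ∀ b a b', E (incl b * a * incl b') = b * E a * b'
  E_pos : ∀ a, 0 ≤ E (star a * a)

namespace BProbSpace

/-- Evaluation `f(𝒳) ↦ f(x)` of polynomials at `x : A`. -/
def eval {B A : Type*} [CStarAlgebra B] [PartialOrder B] [StarOrderedRing B] [CStarAlgebra A]
    (P : BProbSpace B A) (x : A) : NCPoly B →ₐ[ℂ] A :=
  NCPoly.lift P.incl.toAlgHom x

/-- The distribution `f(𝒳) ↦ E(f(x))` of `x`. -/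
def law {B A : Type*} [CStarAlgebra B] [PartialOrder B] [StarOrderedRing B] [CStarAlgebra A]
    (P : BProbSpace B A) (x : A) : NCPoly B →ₗ[ℂ] B :=
  P.E ∘ₗ (P.eval x).toLinearMap

/-- Monotone independence over `B` of a family indexed by a totally ordered set: in an alternating
product of elements `aₗ ∈ B⟨x (ε l)⟩₀`, a factor `aⱼ` whose index is larger than the indices of its
(existing) neighbours may be replaced under `E` by `E(aⱼ)`. -/
def MonotoneIndep {B A : Type*} [CStarAlgebra B] [PartialOrder B] [StarOrderedRing B]
    [CStarAlgebra A] (P : BProbSpace B A) {I : Type*} [LinearOrder I] (x : I → A) : Prop :=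
  ∀ (n : ℕ) (ε : Fin n → I) (a : Fin n → A),
    (∀ l, a l ∈ P.eval (x (ε l)) '' NCPoly.noFreeTerm B) →
    (∀ k l : Fin n, (k : ℕ) + 1 = l → ε k ≠ ε l) →
    ∀ j : Fin n,
      (∀ l : Fin n, (l : ℕ) + 1 = j ∨ (j : ℕ) + 1 = l → ε l < ε j) →
      P.E (List.ofFn a).prod =
        P.E (List.ofFn (Function.update a j (P.incl (P.E (a j))))).prod

/-- A sequence of centered, identically distributed, monotone independent self-adjoint elements. -/
structure IsMonotoneIID {B A : Type*} [CStarAlgebra B] [PartialOrder B] [StarOrderedRing B]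
    [CStarAlgebra A] (P : BProbSpace B A) (x : ℕ → A) : Prop where
  selfAdjoint : ∀ i, IsSelfAdjoint (x i)
  centered : ∀ i, P.E (x i) = 0
  identDistrib : ∀ i j, P.law (x i) = P.law (x j)
  monotoneIndep : P.MonotoneIndep x

/-- The normalized sum `(x₀ + ⋯ + x_{N-1}) / √N`. -/
def normalizedSum {A : Type*} [CStarAlgebra A] (x : ℕ → A) (N : ℕ) : A :=
  ((Real.sqrt N)⁻¹ : ℂ) • ∑ i ∈ Finset.range N, x i

/-- `𝔞` is the monotone central limit (operator-valued arcsine) law of the sequence `x`: the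
distributions of the normalized sums converge to `𝔞` weakly, i.e. on every polynomial. -/
def IsArcsineLaw {B A : Type*} [CStarAlgebra B] [PartialOrder B] [StarOrderedRing B]
    [CStarAlgebra A] (P : BProbSpace B A) (x : ℕ → A) (𝔞 : NCPoly B →ₗ[ℂ] B) : Prop :=
  ∀ f : NCPoly B, Tendsto (fun N => P.law (normalizedSum x N) f) atTop (𝓝 (𝔞 f))

end BProbSpace

end

/-! For each matrix size `m` the moments of `x` are packed into a formal multilinear series on
`M_m(B)`, whose term of degree `n + 1` is `(b₀, …, bₙ) ↦ E(b₀ x b₁ ⋯ x bₙ)` (`momentFMS`). If `y`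
lies below `z` in the monotone order, expand a word in `y + z`, group it by its maximal subwords
without `y`, and replace each such subword by its expectation. The result is the composition of the
two series (`MonotoneIndep.momentFMS_add`), so the series of `x₁ + ⋯ + x_N` is the `N`-th iterate of
the series `ν` of one variable.

Right composition with `ν` is a linear operator `R`, hence the iterate is `∑ₖ (N choose k) (R - 1)ᵏ
id`. Here `ν` has identity linear part, and centering kills its quadratic part, so `(R - 1)ᵏ id`
starts in degree `2k + 1`. Dilation by `1/√N` multiplies degree `n` by `N^(-(n-1)/2)`, and only `2k
+ 1 = n` survives, with coefficient `1/k!` (`tendsto_compIter`). This is the central limit theorem.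
The bound `k! (2‖ν 3‖)ᵏ` on the leading term (`norm_compDiff_le`), with `‖ν 3‖ ≤ ‖x‖²` for every
`m`, gives exponential growth uniformly in `m`.

Since the `2N`-th iterate is the `N`-th composed with itself, the limit series composed with itself
is its dilation by `√2` (`compLimit_comp_compLimit`). On a ball this passes to the transforms by the
identity theorem for analytic functions. On a nilpotent `T` all sums are finite and the identity
extends from small multiples of `T` to `T`. The statement on `y + z` is the same series identity
read for `m = 1`. -/

noncomputable section

/-! ### Iterates of a formal multilinear series and their finite differences -/

namespace FormalMultilinearSeries

variable {E : Type*} [NormedAddCommGroup E] [NormedSpace ℂ E]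

/-- Composition on the right with a fixed formal multilinear series, as a linear map. -/
def compRight (ν : FormalMultilinearSeries ℂ E E) :
    FormalMultilinearSeries ℂ E E →ₗ[ℂ] FormalMultilinearSeries ℂ E E where
  toFun F := F.comp ν
  map_add' F G := by
    ext n v
    simp [FormalMultilinearSeries.comp, Finset.sum_add_distrib]
  map_smul' c F := by
    ext n v
    simp [FormalMultilinearSeries.comp, Finset.smul_sum]

theorem compRight_apply (ν F : FormalMultilinearSeries ℂ E E) : compRight ν F = F.comp ν := rfl

/-- The iterates `ν ∘ ⋯ ∘ ν` of a formal multilinear series. -/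
def compIter (ν : FormalMultilinearSeries ℂ E E) : ℕ → FormalMultilinearSeries ℂ E E
  | 0 => FormalMultilinearSeries.id ℂ E 0
  | N + 1 => (compIter ν N).comp ν

theorem compIter_add (ν : FormalMultilinearSeries ℂ E E) (M N : ℕ) :
    compIter ν (M + N) = (compIter ν M).comp (compIter ν N) := by
  induction N with
  | zero => simp [compIter]
  | succ N ih => rw [← add_assoc, compIter, ih, compIter, comp_assoc]

/-- The iterated differences of the sequence of iterates of `ν`. -/
def compDiff (ν : FormalMultilinearSeries ℂ E E) (k : ℕ) : FormalMultilinearSeries ℂ E E :=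
  ((compRight ν - 1 : Module.End ℂ (FormalMultilinearSeries ℂ E E)) ^ k)
    (FormalMultilinearSeries.id ℂ E 0)

theorem compDiff_zero (ν : FormalMultilinearSeries ℂ E E) :
    compDiff ν 0 = FormalMultilinearSeries.id ℂ E 0 := rfl

theorem compDiff_succ (ν : FormalMultilinearSeries ℂ E E) (k : ℕ) :
    compDiff ν (k + 1) = (compDiff ν k).comp ν - compDiff ν k := by
  rw [compDiff, pow_succ']
  rfl

/-- Composition is linear in its left factor, so the iterate is a power of the operator `compRight
ν` applied to the identity. The binomial theorem for `compRight ν = (compRight ν - 1) + 1` gives the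
formula. -/
theorem compIter_eq_sum (ν : FormalMultilinearSeries ℂ E E) (N : ℕ) :
    compIter ν N = ∑ k ∈ Finset.range (N + 1), N.choose k • compDiff ν k := by
  have h : compIter ν N = ((compRight ν : Module.End ℂ (FormalMultilinearSeries ℂ E E)) ^ N)
      (FormalMultilinearSeries.id ℂ E 0) := by
    induction N with
    | zero => rfl
    | succ N ih => rw [compIter, ih, pow_succ', Module.End.mul_apply, compRight_apply]
  have h2 : (compRight ν : Module.End ℂ (FormalMultilinearSeries ℂ E E)) =
      (compRight ν - 1) + 1 := by abel
  rw [h, h2, (Commute.one_right _).add_pow]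
  rw [LinearMap.sum_apply]
  refine Finset.sum_congr rfl fun k _ => ?_
  rw [one_pow, mul_one, ← nsmul_eq_mul', LinearMap.smul_apply]
  rfl

theorem compAlongComposition_ones {ν : FormalMultilinearSeries ℂ E E}
    (h1 : ∀ v, ν 1 v = v 0) (F : FormalMultilinearSeries ℂ E E) (n : ℕ) :
    F.compAlongComposition ν (Composition.ones n) = F n := by
  ext v
  rw [compAlongComposition_apply]
  refine F.congr (Composition.ones_length n) fun i hi hi' => ?_
  rw [applyComposition_ones]
  exact h1 _

/-- The composition into ones contributes `F n` itself because `ν 1` is the identity; subtracting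
`F` removes exactly this term. -/
theorem comp_sub_self_apply {ν : FormalMultilinearSeries ℂ E E}
    (h1 : ∀ v, ν 1 v = v 0) (F : FormalMultilinearSeries ℂ E E) (n : ℕ) :
    (F.comp ν - F) n =
      ∑ c ∈ Finset.univ.erase (Composition.ones n), F.compAlongComposition ν c := by
  have h : (F.comp ν) n = ∑ c, F.compAlongComposition ν c := rfl
  rw [FormalMultilinearSeries.sub_apply, h,
    ← Finset.add_sum_erase _ _ (Finset.mem_univ (Composition.ones n)),
    compAlongComposition_ones h1]
  abel

theorem compAlongComposition_eq_zero_of_block {ν F : FormalMultilinearSeries ℂ E E} {j : ℕ}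
    (hj : ν j = 0) {n : ℕ} {c : Composition n} (hc : j ∈ c.blocks) :
    F.compAlongComposition ν c = 0 := by
  ext v
  obtain ⟨i, rfl⟩ := List.mem_iff_get.1 hc
  rw [compAlongComposition_apply]
  refine ContinuousMultilinearMap.map_coord_zero _ i ?_
  have : ν (c.blocksFun i) = 0 := hj
  simp [applyComposition, this]

end FormalMultilinearSeries

/-! ### Lists of positive integers whose sum exceeds the length by at most two -/

theorem List.length_le_sum_of_forall_one_le {l : List ℕ} (h : ∀ x ∈ l, 1 ≤ x) :
    l.length ≤ l.sum := by
  simpa using l.card_nsmul_le_sum 1 h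

theorem List.eq_replicate_one_of_sum_le {l : List ℕ} (h : ∀ x ∈ l, 1 ≤ x)
    (hs : l.sum ≤ l.length) : l = List.replicate l.length 1 := by
  induction l with
  | nil => rfl
  | cons a l ih =>
    have h1 := List.length_le_sum_of_forall_one_le fun x hx => h x (List.mem_cons_of_mem _ hx)
    have ha := h a List.mem_cons_self
    simp only [List.sum_cons, List.length_cons] at hs
    have ha' : a = 1 := by omega
    rw [List.length_cons, List.replicate_succ, ← ih (fun x hx => h x (List.mem_cons_of_mem _ hx))
      (by omega), ha']

/-- An entry other than `1` and `2` is at least `3` and alone contributes an excess of two. The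
exclusion of `2` reflects the vanishing of the quadratic coefficient. -/
theorem List.length_add_two_le_sum {l : List ℕ} (h : ∀ x ∈ l, 1 ≤ x) (h2 : 2 ∉ l)
    (hl : ∃ x ∈ l, x ≠ 1) : l.length + 2 ≤ l.sum := by
  induction l with
  | nil => simp at hl
  | cons a l ih =>
    have h1 := List.length_le_sum_of_forall_one_le fun x hx => h x (List.mem_cons_of_mem _ hx)
    have ha := h a List.mem_cons_self
    have ha2 : a ≠ 2 := fun h => h2 (h ▸ List.mem_cons_self)
    simp only [List.sum_cons, List.length_cons]
    by_cases ha1 : a = 1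
    · have := ih (fun x hx => h x (List.mem_cons_of_mem _ hx))
        (fun h => h2 (List.mem_cons_of_mem _ h)) (by
          obtain ⟨x, hx, hx1⟩ := hl
          rcases List.mem_cons.1 hx with rfl | hx
          · exact absurd ha1 hx1
          · exact ⟨x, hx, hx1⟩)
      omega
    · omega

theorem List.eq_replicate_append_three {l : List ℕ} (h : ∀ x ∈ l, 1 ≤ x) (h2 : 2 ∉ l)
    (hs : l.sum = l.length + 2) :
    ∃ i j, l = List.replicate i 1 ++ 3 :: List.replicate j 1 := by
  induction l with
  | nil => simp at hs
  | cons a l ih =>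
    have h1 := List.length_le_sum_of_forall_one_le fun x hx => h x (List.mem_cons_of_mem _ hx)
    have ha := h a List.mem_cons_self
    have ha2 : a ≠ 2 := fun h => h2 (h ▸ List.mem_cons_self)
    simp only [List.sum_cons, List.length_cons] at hs
    by_cases ha1 : a = 1
    · obtain ⟨i, j, hij⟩ := ih (fun x hx => h x (List.mem_cons_of_mem _ hx))
        (fun h => h2 (List.mem_cons_of_mem _ h)) (by omega)
      exact ⟨i + 1, j, by rw [List.replicate_succ, List.cons_append, ← hij, ha1]⟩
    · refine ⟨0, l.length, ?_⟩
      rw [← List.eq_replicate_one_of_sum_le (fun x hx => h x (List.mem_cons_of_mem _ hx))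
        (by omega)]
      simp; omega

/-! ### Order and size of the differences, and the limit of the normalized iterates -/

namespace FormalMultilinearSeries

variable {E : Type*} [NormedAddCommGroup E] [NormedSpace ℂ E]

theorem length_add_two_le_of_two_notMem {n : ℕ} {c : Composition n} (hc : c ≠ Composition.ones n)
    (h2 : 2 ∉ c.blocks) : c.length + 2 ≤ n := by
  obtain ⟨x, hx, hx1⟩ := Composition.ne_ones_iff.1 hc
  have := List.length_add_two_le_sum (fun _ h => c.one_le_blocks h) h2 ⟨x, hx, hx1.ne'⟩
  rwa [c.blocks_sum] at this

/-- A composition other than the one into ones, with no block `2`, has at least two blocks fewer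
than its degree. In degree below `n + 2` it therefore involves only coefficients of `F` below `n`:
each difference raises the order by two. -/
theorem comp_sub_self_eq_zero {ν : FormalMultilinearSeries ℂ E E}
    (h1 : ∀ v, ν 1 v = v 0) (h2 : ν 2 = 0) {F : FormalMultilinearSeries ℂ E E} {n : ℕ}
    (hF : ∀ j < n, F j = 0) : ∀ j < n + 2, (F.comp ν - F) j = 0 := by
  intro j hj
  rw [comp_sub_self_apply h1]
  refine Finset.sum_eq_zero fun c hc => ?_
  by_cases hc2 : 2 ∈ c.blocks
  · exact compAlongComposition_eq_zero_of_block h2 hc2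
  · have := length_add_two_le_of_two_notMem (Finset.ne_of_mem_erase hc) hc2
    ext v
    rw [compAlongComposition_apply, hF _ (by omega)]
    rfl

/-- Compositions of `n + 2` into `n` parts without a part `2`: all parts are `1` except one `3`. -/
theorem card_composition_le (n : ℕ) :
    (Finset.univ.filter fun c : Composition (n + 2) => c.length = n ∧ 2 ∉ c.blocks).card ≤ n := by
  have key : ∀ c : Composition (n + 2), c.length = n → 2 ∉ c.blocks →
      ∃ i j, c.blocks = List.replicate i 1 ++ 3 :: List.replicate j 1 := fun c hc h2 =>
    List.eq_replicate_append_three (fun _ h => c.one_le_blocks h) h2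
      (by rw [c.blocks_sum, c.blocks_length, hc])
  have hidx : ∀ i j : ℕ, (List.replicate i 1 ++ 3 :: List.replicate j 1).idxOf 3 = i := by
    intro i j
    rw [List.idxOf_append_of_notMem (by simp [List.mem_replicate])]
    simp
  calc _ ≤ (Finset.range n).card := ?_
    _ = n := Finset.card_range n
  -- Such a composition is determined by the position of its block `3`.
  refine Finset.card_le_card_of_injOn (fun c => c.blocks.idxOf 3) ?_ ?_
  · intro c hc
    simp only [Finset.coe_filter, Finset.mem_univ, true_and, Set.mem_ofPred_eq] at hc
    obtain ⟨i, j, h⟩ := key c hc.1 hc.2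
    have hl := c.blocks_length
    rw [h, hc.1] at hl
    simp only [h, hidx, Finset.coe_range, Set.mem_Iio]
    simp at hl
    omega
  · intro c hc c' hc' hcc
    simp only [Finset.coe_filter, Finset.mem_univ, true_and, Set.mem_ofPred_eq] at hc hc'
    obtain ⟨i, j, h⟩ := key c hc.1 hc.2
    obtain ⟨i', j', h'⟩ := key c' hc'.1 hc'.2
    have hl := c.blocks_length
    rw [h, hc.1] at hl
    have hl' := c'.blocks_length
    rw [h', hc'.1] at hl'
    simp only [h, h', hidx] at hcc
    subst hcc
    simp at hl hl'
    have : j = j' := by omega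
    subst this
    ext1
    rw [h, h']

/-- In this first possibly nonzero degree only compositions into `n` blocks without a `2`
contribute. There are at most `n` of them, and each has one factor `ν 3`, all others being `ν 1` of
norm at most one. -/
theorem norm_comp_sub_self_le {ν : FormalMultilinearSeries ℂ E E}
    (h1 : ∀ v, ν 1 v = v 0) (h2 : ν 2 = 0) {F : FormalMultilinearSeries ℂ E E} {n : ℕ}
    (hF : ∀ j < n, F j = 0) : ‖(F.comp ν - F) (n + 2)‖ ≤ n * (‖ν 3‖ * ‖F n‖) := by
  have hν1 : ‖ν 1‖ ≤ 1 := by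
    refine ContinuousMultilinearMap.opNorm_le_bound zero_le_one fun v => ?_
    simp [h1]
  set S := Finset.univ.filter fun c : Composition (n + 2) => c.length = n ∧ 2 ∉ c.blocks
  have hsub : S ⊆ Finset.univ.erase (Composition.ones (n + 2)) := by
    intro c hc
    rw [Finset.mem_erase]
    refine ⟨?_, Finset.mem_univ _⟩
    rintro rfl
    have := (Finset.mem_filter.1 hc).2.1
    simp at this
  rw [comp_sub_self_apply h1, ← Finset.sum_subset hsub]
  · calc _ ≤ ∑ c ∈ S, ‖ν 3‖ * ‖F n‖ := ?_
      _ ≤ _ := by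
        rw [Finset.sum_const, nsmul_eq_mul]
        gcongr
        exact card_composition_le n
    refine norm_sum_le_of_le _ fun c hc => ?_
    refine (compAlongComposition_norm _ _ _).trans ?_
    obtain ⟨hc1, hc2⟩ := (Finset.mem_filter.1 hc).2
    rw [mul_comm]
    have hF' : ‖F c.length‖ = ‖F n‖ := congrArg (fun k => ‖F k‖) hc1
    rw [hF']
    gcongr
    obtain ⟨i, j, h⟩ := List.eq_replicate_append_three (fun _ h => c.one_le_blocks h) hc2
      (by rw [c.blocks_sum, c.blocks_length, hc1])
    have : ∏ i, ‖ν (c.blocksFun i)‖ = (c.blocks.map fun k => ‖ν k‖).prod := by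
      rw [← c.ofFn_blocksFun, List.map_ofFn, List.prod_ofFn]
      rfl
    rw [this, h]
    simp only [List.map_append, List.map_replicate, List.map_cons, List.prod_append,
      List.prod_replicate, List.prod_cons]
    calc _ ≤ 1 ^ i * (‖ν 3‖ * 1 ^ j) := by gcongr
      _ = _ := by simp
  · intro c hc hcS
    by_cases hc2 : 2 ∈ c.blocks
    · exact compAlongComposition_eq_zero_of_block h2 hc2
    · have := length_add_two_le_of_two_notMem (Finset.ne_of_mem_erase hc) hc2
      have h3 : c.length ≠ n := fun h => hcS (Finset.mem_filter.2 ⟨Finset.mem_univ _, h, hc2⟩)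
      ext v
      rw [compAlongComposition_apply, hF _ (by omega)]
      rfl

theorem compDiff_eq_zero {ν : FormalMultilinearSeries ℂ E E}
    (h1 : ∀ v, ν 1 v = v 0) (h2 : ν 2 = 0) (k : ℕ) : ∀ j < 2 * k + 1, compDiff ν k j = 0 := by
  induction k with
  | zero =>
    intro j hj
    obtain rfl : j = 0 := by omega
    ext v
    rw [compDiff_zero]
    exact id_apply_zero _ _ _ _
  | succ k ih =>
    rw [compDiff_succ]
    exact comp_sub_self_eq_zero h1 h2 ih

/-- Passing from `k` to `k + 1` costs a factor `(2k + 1)‖ν 3‖ ≤ 2(k + 1)‖ν 3‖`. The resulting `k!`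
is cancelled by the `1/k!` in `compLimit`. -/
theorem norm_compDiff_le {ν : FormalMultilinearSeries ℂ E E}
    (h1 : ∀ v, ν 1 v = v 0) (h2 : ν 2 = 0) (k : ℕ) :
    ‖compDiff ν k (2 * k + 1)‖ ≤ k.factorial * (2 * ‖ν 3‖) ^ k := by
  induction k with
  | zero =>
    simp only [Nat.factorial_zero, Nat.cast_one, pow_zero, mul_one]
    refine ContinuousMultilinearMap.opNorm_le_bound zero_le_one fun v => ?_
    rw [compDiff_zero]
    simp [id_apply_one]
  | succ k ih =>
    rw [compDiff_succ]
    refine (norm_comp_sub_self_le h1 h2 (compDiff_eq_zero h1 h2 k)).trans ?_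
    calc _ ≤ ((2 * k + 1 : ℕ) : ℝ) * (‖ν 3‖ * (k.factorial * (2 * ‖ν 3‖) ^ k)) := by gcongr
      _ ≤ (2 * (k + 1)) * (‖ν 3‖ * (k.factorial * (2 * ‖ν 3‖) ^ k)) := by
        gcongr; push_cast; linarith
      _ = _ := by rw [Nat.factorial_succ]; push_cast; ring

/-- The number of summands is made independent of `N`, so that the limit can be taken termwise:
summands with `k > N` vanish by the binomial coefficient, those with `k > n` by the order of
`compDiff`. -/
theorem compIter_apply {ν : FormalMultilinearSeries ℂ E E}
    (h1 : ∀ v, ν 1 v = v 0) (h2 : ν 2 = 0) (N n : ℕ) :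
    compIter ν N n = ∑ k ∈ Finset.range (n + 1), (N.choose k : ℂ) • compDiff ν k n := by
  have h : compIter ν N n = ∑ k ∈ Finset.range (N + 1), (N.choose k : ℂ) • compDiff ν k n := by
    rw [compIter_eq_sum]
    refine (Finset.sum_apply n _ _).trans (Finset.sum_congr rfl fun k _ => ?_)
    rw [Nat.cast_smul_eq_nsmul]
    rfl
  have hz : ∀ M, n ≤ M → N ≤ M → ∑ k ∈ Finset.range (M + 1), (N.choose k : ℂ) • compDiff ν k n
      = ∑ k ∈ Finset.range (N + 1), (N.choose k : ℂ) • compDiff ν k n := by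
    intro M _ hM
    refine (Finset.sum_subset (by simpa using hM) fun k _ hk => ?_).symm
    rw [Nat.choose_eq_zero_of_lt (by simpa using hk)]
    simp
  have hz' : ∀ M, n ≤ M → N ≤ M → ∑ k ∈ Finset.range (M + 1), (N.choose k : ℂ) • compDiff ν k n
      = ∑ k ∈ Finset.range (n + 1), (N.choose k : ℂ) • compDiff ν k n := by
    intro M hM _
    refine (Finset.sum_subset (by simpa using hM) fun k _ hk => ?_).symm
    rw [compDiff_eq_zero h1 h2 k n (by simp at hk; omega), smul_zero]
  rw [h, ← hz (max n N) (le_max_left _ _) (le_max_right _ _),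
    hz' (max n N) (le_max_left _ _) (le_max_right _ _)]

/-- The limit of the normalized iterates of `ν`. -/
def compLimit (ν : FormalMultilinearSeries ℂ E E) : FormalMultilinearSeries ℂ E E := fun n =>
  ∑ k ∈ Finset.range (n + 1), if 2 * k + 1 = n then (k.factorial : ℂ)⁻¹ • compDiff ν k n else 0

theorem inv_sqrt_sq (N : ℕ) : ((Real.sqrt N : ℂ)⁻¹) ^ 2 = (N : ℂ)⁻¹ := by
  rw [inv_pow, ← Complex.ofReal_pow, Real.sq_sqrt (Nat.cast_nonneg N)]
  simp

theorem tendsto_inv_sqrt : Tendsto (fun N : ℕ => (Real.sqrt N : ℂ)⁻¹) atTop (𝓝 0) := by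
  have : Tendsto (fun N : ℕ => (Real.sqrt N)⁻¹) atTop (𝓝 0) :=
    tendsto_inv_atTop_zero.comp (Real.tendsto_sqrt_atTop.comp tendsto_natCast_atTop_atTop)
  have := (Complex.continuous_ofReal.tendsto 0).comp this
  simpa [Function.comp_def] using this

theorem tendsto_choose_mul_inv_sqrt_pow (k : ℕ) :
    Tendsto (fun N : ℕ => (N.choose k : ℂ) * ((Real.sqrt N : ℂ)⁻¹) ^ (2 * k)) atTop
      (𝓝 (k.factorial : ℂ)⁻¹) := by
  have h : Tendsto (fun N : ℕ => (N.choose k : ℝ) * ((N : ℝ)⁻¹) ^ k) atTop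
      (𝓝 ((1 : ℝ) ^ k / k.factorial)) := by
    -- This is the asymptotics behind the Poisson limit theorem, with parameter `1/N` and rate `1`.
    refine ProbabilityTheory.tendsto_choose_mul_pow_atTop (r := 1) k ?_
    refine tendsto_const_nhds.congr' ?_
    filter_upwards [eventually_gt_atTop 0] with N hN
    have : (N : ℝ) ≠ 0 := by positivity
    field_simp
  have h2 := (Complex.continuous_ofReal.tendsto _).comp h
  simp only [Function.comp_def] at h2
  convert! h2 using 2
  · rw [pow_mul, inv_sqrt_sq]; push_cast; rfl
  · simp

/-- The `k`-th summand has scalar factor of order `N^(k - (n-1)/2)`: it converges when `2k + 1 = n`,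
tends to zero when `2k + 1 < n`, and `compDiff ν k n` is zero when `2k + 1 > n`. -/
theorem tendsto_compIter {ν : FormalMultilinearSeries ℂ E E}
    (h1 : ∀ v, ν 1 v = v 0) (h2 : ν 2 = 0) (n : ℕ) :
    Tendsto (fun N : ℕ => ((Real.sqrt N : ℂ)⁻¹) ^ (n - 1) • compIter ν N n) atTop
      (𝓝 (compLimit ν n)) := by
  simp only [compIter_apply h1 h2, Finset.smul_sum, smul_smul, compLimit]
  refine tendsto_finsetSum _ fun k _ => ?_
  split_ifs with hk
  · subst hk
    simp only [Nat.add_sub_cancel, mul_comm _ ((Nat.choose _ k : ℂ))]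
    exact (tendsto_choose_mul_inv_sqrt_pow k).smul_const _
  · rcases Nat.lt_or_gt_of_ne hk with hk | hk
    · have he : n - 1 = 2 * k + (n - 1 - 2 * k) := by omega
      have h0 : n - 1 - 2 * k ≠ 0 := by omega
      have h3 := (tendsto_choose_mul_inv_sqrt_pow k).mul (tendsto_inv_sqrt.pow (n - 1 - 2 * k))
      rw [zero_pow h0, mul_zero] at h3
      have h4 := h3.smul_const (compDiff ν k n)
      rw [zero_smul] at h4
      refine h4.congr fun N => ?_
      conv_rhs => rw [he]
      rw [pow_add]; ring_nf
    · simp only [compDiff_eq_zero h1 h2 k n hk, smul_zero]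
      exact tendsto_const_nhds

theorem norm_compLimit_le {ν : FormalMultilinearSeries ℂ E E}
    (h1 : ∀ v, ν 1 v = v 0) (h2 : ν 2 = 0) {M : ℝ} (hM : 0 ≤ M) (h3 : 2 * ‖ν 3‖ ≤ M ^ 2) (n : ℕ) :
    ‖compLimit ν n‖ ≤ M ^ (n - 1) := by
  by_cases hn : ∃ k, 2 * k + 1 = n
  · obtain ⟨k, rfl⟩ := hn
    rw [compLimit, Finset.sum_eq_single_of_mem k (by simp; omega)
      (fun j _ hj => if_neg (by omega)), if_pos rfl, norm_smul, norm_inv, Complex.norm_natCast,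
      inv_mul_le_iff₀ (by positivity), Nat.add_sub_cancel, pow_mul]
    refine (norm_compDiff_le h1 h2 k).trans ?_
    gcongr
  · rw [compLimit, Finset.sum_eq_zero fun k _ => if_neg fun h => hn ⟨k, h⟩, norm_zero]
    positivity

theorem compLimit_zero {ν : FormalMultilinearSeries ℂ E E} : compLimit ν 0 = 0 := by
  simp [compLimit]

/-- The dilation of a formal multilinear series, leaving the linear term unchanged. -/
def dil (c : ℂ) (p : FormalMultilinearSeries ℂ E E) : FormalMultilinearSeries ℂ E E :=
  fun n => c ^ (n - 1) • p n

/-- The weight `n - 1` is additive: for a composition of `n` into `l` blocks of sizes `kᵢ`, `(l - 1)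
+ ∑ (kᵢ - 1) = n - 1`. -/
theorem dil_comp_dil (c : ℂ) (q p : FormalMultilinearSeries ℂ E E) :
    (dil c q).comp (dil c p) = dil c (q.comp p) := by
  ext n v
  simp only [FormalMultilinearSeries.comp, dil, _root_.sum_apply,
    _root_.smul_apply, compAlongComposition_apply, Finset.smul_sum]
  refine Finset.sum_congr rfl fun d _ => ?_
  have : (dil c p).applyComposition d v =
      fun i => c ^ (d.blocksFun i - 1) • p.applyComposition d v i := rfl
  change c ^ (d.length - 1) • q d.length ((dil c p).applyComposition d v) = _
  rw [this, ContinuousMultilinearMap.map_smul_univ, smul_smul, Finset.prod_pow_eq_pow_sum,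
    ← pow_add]
  congr 2
  have h1 : ∑ i, (d.blocksFun i - 1) + d.length = n := by
    conv_rhs => rw [← d.sum_blocksFun]
    rw [← Finset.sum_congr rfl fun i _ => Nat.sub_add_cancel (d.one_le_blocksFun i),
      Finset.sum_add_distrib]
    simp
  -- Truncated subtraction does no harm, since `l = 0` only for `n = 0`.
  have h2 : 0 < d.length ↔ 0 < n := d.length_pos_iff
  omega

theorem tendsto_comp {q p : ℕ → FormalMultilinearSeries ℂ E E}
    {q' p' : FormalMultilinearSeries ℂ E E} (hq : ∀ n, Tendsto (fun N => q N n) atTop (𝓝 (q' n)))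
    (hp : ∀ n, Tendsto (fun N => p N n) atTop (𝓝 (p' n))) (n : ℕ) (v : Fin n → E) :
    Tendsto (fun N => (q N).comp (p N) n v) atTop (𝓝 (q'.comp p' n v)) := by
  simp only [FormalMultilinearSeries.comp, _root_.sum_apply,
    compAlongComposition_apply]
  refine tendsto_finsetSum _ fun d _ => ?_
  refine (hq _).eval (tendsto_pi_nhds.2 fun i => ?_)
  exact (hp _).eval_const _

/-- The `N`-th iterate composed with itself is the `2N`-th, and dilation by `1/√N` is dilation by
`√2` after dilation by `1/√(2N)`. The two sides are the limits of the same sequence, read along `N`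
and along `2N`. -/
theorem compLimit_comp_compLimit {ν : FormalMultilinearSeries ℂ E E}
    (h1 : ∀ v, ν 1 v = v 0) (h2 : ν 2 = 0) :
    (compLimit ν).comp (compLimit ν) = dil (Real.sqrt 2 : ℂ) (compLimit ν) := by
  ext n v
  have hG := tendsto_compIter h1 h2
  have hl := tendsto_comp (q := fun N => dil (Real.sqrt N : ℂ)⁻¹ (compIter ν N))
    (p := fun N => dil (Real.sqrt N : ℂ)⁻¹ (compIter ν N)) hG hG n v
  refine tendsto_nhds_unique hl ?_
  have h2N : Tendsto (fun N : ℕ => 2 * N) atTop atTop :=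
    tendsto_id.const_mul_atTop' two_pos
  have hr := (((hG n).comp h2N).const_smul ((Real.sqrt 2 : ℂ) ^ (n - 1))).eval_const v
  refine hr.congr fun N => ?_
  rw [dil_comp_dil, ← compIter_add, ← two_mul]
  simp only [dil, Function.comp_apply, _root_.smul_apply, smul_smul, ← mul_pow]
  congr 2
  have h0 : (Real.sqrt 2 : ℂ) ≠ 0 := by simp
  push_cast
  rw [Real.sqrt_mul (by norm_num)]
  push_cast
  rw [mul_inv, ← mul_assoc, mul_inv_cancel₀ h0, one_mul]

end FormalMultilinearSeries

end

/-! ### Compositions and the expansion of words in a sum -/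

noncomputable section

namespace Composition

/-- The composition obtained by adding a first block of size one. -/
def consOne {n : ℕ} (c : Composition n) : Composition (n + 1) where
  blocks := 1 :: c.blocks
  blocks_pos := by
    intro i hi
    rcases List.mem_cons.1 hi with rfl | hi
    · exact one_pos
    · exact c.blocks_pos hi
  blocks_sum := by rw [List.sum_cons, c.blocks_sum, add_comm]

theorem exists_blocks_eq_cons {n : ℕ} (c : Composition (n + 1)) :
    ∃ k ks, c.blocks = k :: ks := by
  cases h : c.blocks with
  | nil => simp at h
  | cons k ks => exact ⟨k, ks, rfl⟩

/-- The composition obtained by increasing the size of the first block. -/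
def incHead {n : ℕ} (c : Composition (n + 1)) : Composition (n + 2) where
  blocks := (c.blocks.headI + 1) :: c.blocks.tail
  blocks_pos := by
    intro i hi
    rcases List.mem_cons.1 hi with rfl | hi
    · exact Nat.succ_pos _
    · exact c.blocks_pos (List.mem_of_mem_tail hi)
  blocks_sum := by
    have := c.blocks_sum
    obtain ⟨k, ks, h⟩ := c.exists_blocks_eq_cons
    rw [h] at this ⊢
    simp at this ⊢
    omega

/-- The two summands correspond to a first block equal to one and a first block larger than one. -/
theorem bijective_consOne_incHead (n : ℕ) : Function.Bijective
    (Sum.elim consOne incHead :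
      Composition (n + 1) ⊕ Composition (n + 1) → Composition (n + 2)) := by
  constructor
  · rintro (c | c) (d | d) h
    · have h := congrArg Composition.blocks h
      simp only [Sum.elim_inl, consOne, List.cons.injEq, true_and] at h
      exact congrArg Sum.inl (Composition.ext h)
    · have h := congrArg Composition.blocks h
      simp only [Sum.elim_inl, Sum.elim_inr, consOne, incHead, List.cons.injEq] at h
      obtain ⟨k, ks, hd⟩ := d.exists_blocks_eq_cons
      have := d.blocks_pos (i := k) (by rw [hd]; exact List.mem_cons_self)
      rw [hd] at h
      simp at h; omega
    · have h := congrArg Composition.blocks h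
      simp only [Sum.elim_inl, Sum.elim_inr, consOne, incHead, List.cons.injEq] at h
      obtain ⟨k, ks, hd⟩ := c.exists_blocks_eq_cons
      have := c.blocks_pos (i := k) (by rw [hd]; exact List.mem_cons_self)
      rw [hd] at h
      simp at h; omega
    · have h := congrArg Composition.blocks h
      obtain ⟨k, ks, hc⟩ := c.exists_blocks_eq_cons
      obtain ⟨k', ks', hd⟩ := d.exists_blocks_eq_cons
      simp only [Sum.elim_inr, incHead, hc, hd, List.headI_cons, List.tail_cons,
        List.cons.injEq, add_left_inj] at h
      exact congrArg Sum.inr (Composition.ext (by rw [hc, hd, h.1, h.2]))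
  · intro c
    obtain ⟨k, ks, hc⟩ := c.exists_blocks_eq_cons
    have hk := c.blocks_pos (i := k) (by rw [hc]; exact List.mem_cons_self)
    have hs := c.blocks_sum
    rw [hc, List.sum_cons] at hs
    have hks : ∀ {i}, i ∈ ks → 0 < i := fun {i} hi =>
      c.blocks_pos (by rw [hc]; exact List.mem_cons_of_mem _ hi)
    by_cases h1 : k = 1
    · refine ⟨Sum.inl ⟨ks, hks, by omega⟩, Composition.ext ?_⟩
      simp [consOne, hc, h1]
    · refine ⟨Sum.inr ⟨(k - 1) :: ks, ?_, by rw [List.sum_cons]; omega⟩, Composition.ext ?_⟩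
      · intro i hi
        rcases List.mem_cons.1 hi with rfl | hi
        · omega
        · exact hks hi
      · simp [incHead, hc]; omega

theorem sum_eq_sum_consOne_add_incHead {V : Type*} [AddCommMonoid V] {n : ℕ}
    (f : Composition (n + 2) → V) :
    ∑ c, f c = ∑ c : Composition (n + 1), f c.consOne + ∑ c : Composition (n + 1), f c.incHead := by
  rw [← (Equiv.ofBijective _ (bijective_consOne_incHead n)).sum_comp, Fintype.sum_sum_type]
  rfl

end Composition

theorem List.splitWrtComposition_consOne {α : Type*} {n : ℕ} (b : α) (l : List α)
    (c : Composition n) :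
    (b :: l).splitWrtComposition c.consOne = [b] :: l.splitWrtComposition c := by
  simp [List.splitWrtComposition, Composition.consOne, List.splitWrtCompositionAux]

/-- The new letter joins the first group. That this group is nonempty is what `wordProd_cons` needs
to pull the letter out. -/
theorem List.splitWrtComposition_incHead {α : Type*} {n : ℕ} (b : α) (l : List α)
    (hl : l.length = n + 1) (c : Composition (n + 1)) :
    ∃ h t, h ≠ [] ∧ l.splitWrtComposition c = h :: t ∧
      (b :: l).splitWrtComposition c.incHead = (b :: h) :: t := by
  obtain ⟨k, ks, hc⟩ := c.exists_blocks_eq_cons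
  have hk := c.blocks_pos (i := k) (by rw [hc]; exact List.mem_cons_self)
  refine ⟨l.take k, (l.drop k).splitWrtCompositionAux ks, ?_, ?_, ?_⟩
  · intro h
    have := congrArg List.length h
    simp [hl] at this
    omega
  · simp [List.splitWrtComposition, hc, List.splitWrtCompositionAux]
  · simp [List.splitWrtComposition, Composition.incHead, hc, List.splitWrtCompositionAux]

/-- The product `a₀ x a₁ x ⋯ x aₙ`. -/
def wordProd {R : Type*} [Monoid R] (x : R) : List R → R
  | [] => 1
  | a :: l => a * (l.map (x * ·)).prod

theorem wordProd_singleton {R : Type*} [Monoid R] (x a : R) : wordProd x [a] = a := by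
  simp [wordProd]

theorem wordProd_cons {R : Type*} [Monoid R] (x a : R) {l : List R} (hl : l ≠ []) :
    wordProd x (a :: l) = a * x * wordProd x l := by
  obtain ⟨b, l, rfl⟩ := List.exists_cons_of_ne_nil hl
  simp [wordProd, mul_assoc]

theorem wordProd_mul_cons {R : Type*} [Monoid R] (x a b : R) (l : List R) :
    wordProd x ((a * b) :: l) = a * wordProd x (b :: l) := by
  simp [wordProd, mul_assoc]

/-- Expansion of the word `a₀ (y + z) a₁ (y + z) ⋯ (y + z) aₙ`, grouped by the maximal
subwords which do not contain `y`. -/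
theorem wordProd_add {R : Type*} [Ring R] (y z : R) : ∀ (n : ℕ) (l : List R),
    l.length = n + 1 → wordProd (y + z) l =
      ∑ c : Composition (n + 1), wordProd y ((l.splitWrtComposition c).map (wordProd z)) := by
  intro n
  induction n with
  | zero =>
    intro l hl
    obtain ⟨a, rfl⟩ := List.length_eq_one_iff.1 hl
    have : (Finset.univ : Finset (Composition 1)) = {Composition.ones 1} :=
      (Finset.eq_univ_of_card _ (by simp [composition_card])).symm
    rw [this, Finset.sum_singleton]
    simp [List.splitWrtComposition, List.splitWrtCompositionAux, wordProd]
  | succ n ih =>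
    intro l hl
    obtain ⟨b, l, rfl⟩ := List.exists_cons_of_length_eq_add_one hl
    have hl' : l.length = n + 1 := by simpa using hl
    have hne : l ≠ [] := by rintro rfl; simp at hl'
    -- The connector after the first letter is `y` or `z`: `y` closes a group (`consOne`), while `z`
    -- prolongs the first group of the remaining word (`incHead`).
    rw [wordProd_cons _ _ hne, ih l hl', Composition.sum_eq_sum_consOne_add_incHead, mul_add,
      add_mul, Finset.mul_sum, Finset.mul_sum]
    congr 1
    · refine Finset.sum_congr rfl fun c _ => ?_
      rw [List.splitWrtComposition_consOne, List.map_cons, wordProd_singleton, wordProd_cons]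
      rw [Ne, List.map_eq_nil_iff, ← List.length_eq_zero_iff, List.length_splitWrtComposition,
        c.length_eq_zero]
      omega
    · refine Finset.sum_congr rfl fun c _ => ?_
      obtain ⟨h, t, hh, h1, h2⟩ := List.splitWrtComposition_incHead b l hl' c
      rw [h1, h2, List.map_cons, List.map_cons, wordProd_cons _ _ hh, wordProd_mul_cons]

/-- If the factors in `Z` may be replaced under `Φ` by their images under `Θ` whenever they are
isolated by letters `y`, then all of them may be replaced in a word. -/
theorem map_wordProd_eq {R V : Type*} [Monoid R] (Φ : R → V) (Θ : R → R) (y : R)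
    (S : Submonoid R) (Z : Set R) (hy : y ∈ S) (hZ : Z ⊆ S) (hΘ : ∀ f ∈ Z, Θ f ∈ S)
    (hleft : ∀ f ∈ Z, ∀ r, (r = 1 ∨ ∃ s ∈ S, r = y * s) → Φ (f * r) = Φ (Θ f * r))
    (hmid : ∀ p ∈ S, ∀ f ∈ Z, ∀ r, (r = 1 ∨ ∃ s ∈ S, r = y * s) →
      Φ (p * y * f * r) = Φ (p * y * Θ f * r))
    (l : List R) (hl : ∀ f ∈ l, f ∈ Z) :
    Φ (wordProd y l) = Φ (wordProd y (l.map Θ)) := by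
  have suf : ∀ l : List R, (∀ f ∈ l, f ∈ Z) → (l.map (y * ·)).prod = 1 ∨
      ∃ s ∈ S, (l.map (y * ·)).prod = y * s := by
    intro l hl
    cases l with
    | nil => exact Or.inl rfl
    | cons a l =>
      refine Or.inr ⟨a * (l.map (y * ·)).prod, S.mul_mem (hZ (hl a List.mem_cons_self)) ?_, ?_⟩
      · refine S.list_prod_mem fun x hx => ?_
        obtain ⟨f, hf, rfl⟩ := List.mem_map.1 hx
        exact S.mul_mem hy (hZ (hl f (List.mem_cons_of_mem _ hf)))
      · simp [mul_assoc]
  -- The factors are replaced from left to right; `p` collects the part already treated, which need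
  -- only lie in `S`.
  have main : ∀ l : List R, (∀ f ∈ l, f ∈ Z) → ∀ p ∈ S,
      Φ (p * (l.map (y * ·)).prod) = Φ (p * ((l.map Θ).map (y * ·)).prod) := by
    intro l
    induction l with
    | nil => intros; rfl
    | cons f l ih =>
      intro hl p hp
      have hf := hl f List.mem_cons_self
      have hl' := fun g hg => hl g (List.mem_cons_of_mem _ hg)
      have := ih hl' (p * y * Θ f) (S.mul_mem (S.mul_mem hp hy) (hΘ f hf))
      simp only [List.map_cons, List.prod_cons, ← mul_assoc] at this ⊢
      rw [hmid p hp f hf _ (suf l hl'), this]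
  cases l with
  | nil => rfl
  | cons f l =>
    have hf := hl f List.mem_cons_self
    have hl' := fun g hg => hl g (List.mem_cons_of_mem _ hg)
    simp only [wordProd, List.map_cons]
    rw [hleft f hf _ (suf l hl'), main l hl' _ (hΘ f hf)]

/-- Links the list form of the word expansion to the indexing by `Composition.embedding` used in the
composition of formal multilinear series. -/
theorem List.splitWrtComposition_ofFn {α : Type*} {n : ℕ} (v : Fin n → α) (c : Composition n) :
    (List.ofFn v).splitWrtComposition c =
      List.ofFn fun i => List.ofFn (v ∘ c.embedding i) := by
  refine List.ext_getElem (by simp) fun i h1 h2 => ?_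
  rw [List.getElem_splitWrtComposition, List.getElem_ofFn]
  have hi : i < c.length := by simpa using h1
  have hle := c.sizeUpTo_le (i + 1)
  have hs := c.sizeUpTo_succ hi
  refine List.ext_getElem ?_ fun j h3 h4 => ?_
  · have : c.blocksFun ⟨i, hi⟩ = c.blocks[i] := rfl
    simp only [List.length_drop, List.length_take, List.length_ofFn, this]
    omega
  · simp only [List.getElem_drop, List.getElem_take, List.getElem_ofFn, Function.comp_apply]
    congr 1

end

/-! ### Monotone independence for words in many variables -/

noncomputable section

namespace BProbSpace

variable {B A : Type*} [CStarAlgebra B] [PartialOrder B] [StarOrderedRing B] [CStarAlgebra A]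
  (P : BProbSpace B A)

theorem eval_X (x : A) : P.eval x (NCPoly.X B) = x := NCPoly.lift_X _ _

theorem eval_C (x : A) (b : B) : P.eval x (NCPoly.C B b) = P.incl b := NCPoly.lift_C _ _ _

theorem E_incl_mul (b : B) (a : A) : P.E (P.incl b * a) = b * P.E a := by
  simpa using P.E_bimodule b a 1

theorem E_mul_incl (a : A) (b : B) : P.E (a * P.incl b) = P.E a * b := by
  simpa using P.E_bimodule 1 a b

theorem self_mem_image_noFreeTerm (x : A) : x ∈ P.eval x '' NCPoly.noFreeTerm B :=
  ⟨NCPoly.X B, NCPoly.lift_X _ _, P.eval_X x⟩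

theorem eval_mul_mem_image_noFreeTerm {x a : A} (q : NCPoly B)
    (ha : a ∈ P.eval x '' NCPoly.noFreeTerm B) :
    P.eval x q * a ∈ P.eval x '' NCPoly.noFreeTerm B := by
  obtain ⟨p, hp, rfl⟩ := ha
  refine ⟨q * p, ?_, map_mul _ _ _⟩
  change NCPoly.lift _ _ _ = 0 at hp
  change NCPoly.lift _ _ _ = 0
  rw [map_mul, hp, mul_zero]

theorem mul_eval_mem_image_noFreeTerm {x a : A} (q : NCPoly B)
    (ha : a ∈ P.eval x '' NCPoly.noFreeTerm B) :
    a * P.eval x q ∈ P.eval x '' NCPoly.noFreeTerm B := by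
  obtain ⟨p, hp, rfl⟩ := ha
  refine ⟨p * q, ?_, map_mul _ _ _⟩
  change NCPoly.lift _ _ _ = 0 at hp
  change NCPoly.lift _ _ _ = 0
  rw [map_mul, hp, zero_mul]

variable {I : Type*} (x : I → A)

/-- The product `x_{i₁} b₁ x_{i₂} b₂ ⋯ x_{iₙ} bₙ`. -/
def evalWord (l : List (I × B)) : A := (l.map fun q => x q.1 * P.incl q.2).prod

theorem evalWord_nil : P.evalWord x [] = 1 := rfl

theorem evalWord_cons (q : I × B) (l : List (I × B)) :
    P.evalWord x (q :: l) = x q.1 * P.incl q.2 * P.evalWord x l := by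
  simp [evalWord]

theorem evalWord_append (l l' : List (I × B)) :
    P.evalWord x (l ++ l') = P.evalWord x l * P.evalWord x l' := by
  simp [evalWord]

/-- A coefficient on the right of a word can be absorbed. -/
theorem exists_evalWord_mul_incl (b : B) (l : List (I × B)) (c : B) :
    ∃ b' l', l'.map Prod.fst = l.map Prod.fst ∧
      P.incl b * P.evalWord x l * P.incl c = P.incl b' * P.evalWord x l' := by
  rcases List.eq_nil_or_concat l with rfl | ⟨l, q, rfl⟩
  · exact ⟨b * c, [], rfl, by simp [evalWord_nil]⟩
  · exact ⟨b, l ++ [(q.1, q.2 * c)], by simp, by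
      simp [evalWord_append, evalWord_cons, evalWord_nil, mul_assoc]⟩

theorem evalWord_mem_image_noFreeTerm {i : I} {l : List (I × B)} (hl : l ≠ [])
    (hi : ∀ q ∈ l, q.1 = i) : P.evalWord x l ∈ P.eval (x i) '' NCPoly.noFreeTerm B := by
  induction l with
  | nil => exact absurd rfl hl
  | cons q l ih =>
    have hq : q.1 = i := hi q List.mem_cons_self
    rw [evalWord_cons, hq]
    rcases eq_or_ne l [] with rfl | hl'
    · rw [evalWord_nil, mul_one, ← P.eval_C (x i)]
      exact P.mul_eval_mem_image_noFreeTerm _ (P.self_mem_image_noFreeTerm _)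
    · have := P.eval_mul_mem_image_noFreeTerm (NCPoly.X B * NCPoly.C B q.2)
        (ih hl' fun r hr => hi r (List.mem_cons_of_mem _ hr))
      rwa [map_mul, eval_X, eval_C] at this

/-- Every nonempty word is an alternating product. -/
theorem exists_alternating (b : B) (l : List (I × B)) :
    ∃ L : List (I × A), (∀ e ∈ L, e.2 ∈ P.eval (x e.1) '' NCPoly.noFreeTerm B) ∧
      L.IsChain (fun e e' => e.1 ≠ e'.1) ∧
      L.head?.map Prod.fst = l.head?.map Prod.fst ∧
      L.getLast?.map Prod.fst = l.getLast?.map Prod.fst ∧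
      (l ≠ [] → (L.map Prod.snd).prod = P.incl b * P.evalWord x l) := by
  induction l generalizing b with
  -- The product formula is only required of nonempty words, since a bare coefficient need not lie
  -- in any `B⟨x i⟩₀`.
  | nil => exact ⟨[], by simp, by simp, rfl, rfl, fun h => absurd rfl h⟩
  | cons q l ih =>
    rcases eq_or_ne l [] with rfl | hl
    · refine ⟨[(q.1, P.incl b * (x q.1 * P.incl q.2))], ?_, by simp, rfl, rfl, ?_⟩
      · intro e he
        obtain rfl := List.mem_singleton.1 he
        have := P.eval_mul_mem_image_noFreeTerm (NCPoly.C B b)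
          (P.mul_eval_mem_image_noFreeTerm (NCPoly.C B q.2) (P.self_mem_image_noFreeTerm (x q.1)))
        rwa [eval_C, eval_C] at this
      · intro _
        simp [evalWord_cons, evalWord_nil]
    · obtain ⟨L, hL, hc, hh, hg, hp⟩ := ih q.2
      have hp := hp hl
      cases L with
      | nil =>
        obtain ⟨r, l, rfl⟩ := List.exists_cons_of_ne_nil hl
        simp at hh
      | cons e L =>
        have hgl : ∀ f : I × A, (f :: e :: L).getLast?.map Prod.fst =
            (q :: l).getLast?.map Prod.fst := by
          intro f
          obtain ⟨r, l, rfl⟩ := List.exists_cons_of_ne_nil hl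
          rw [List.getLast?_cons_cons, List.getLast?_cons_cons, hg]
        -- A letter with the index of the next factor is merged into it; otherwise it opens a new
        -- factor.
        by_cases hqe : q.1 = e.1
        · refine ⟨(e.1, P.incl b * (x e.1 * e.2)) :: L, ?_, ?_, ?_, ?_, ?_⟩
          · intro f hf
            rcases List.mem_cons.1 hf with rfl | hf
            · have := P.eval_mul_mem_image_noFreeTerm (NCPoly.C B b * NCPoly.X B)
                (hL e List.mem_cons_self)
              rwa [map_mul, eval_C, eval_X, mul_assoc] at this
            · exact hL f (List.mem_cons_of_mem _ hf)
          · rw [List.isChain_cons] at hc ⊢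
            exact hc
          · simp [hqe]
          · rw [← hgl e]
            cases L with
            | nil => simp
            | cons f L => simp only [List.getLast?_cons_cons]
          · intro _
            rw [List.map_cons, List.prod_cons] at hp
            rw [List.map_cons, List.prod_cons, evalWord_cons, hqe, mul_assoc, mul_assoc, hp]
            simp only [mul_assoc]
        · refine ⟨(q.1, P.incl b * x q.1) :: e :: L, ?_, ?_, rfl, hgl _, ?_⟩
          · intro f hf
            rcases List.mem_cons.1 hf with rfl | hf
            · have := P.eval_mul_mem_image_noFreeTerm (NCPoly.C B b)
                (P.self_mem_image_noFreeTerm (x q.1))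
              rwa [eval_C] at this
            · exact hL f hf
          · rw [List.isChain_cons_cons]
            exact ⟨hqe, hc⟩
          · intro _
            rw [List.map_cons, List.prod_cons, hp, evalWord_cons]
            simp only [mul_assoc]

/-- The algebra generated by `B` and the elements `x i` with `i ∈ s`. -/
def genAlg (s : Set I) : Subalgebra ℂ A := Algebra.adjoin ℂ (Set.range P.incl ∪ x '' s)

theorem incl_mem_genAlg (s : Set I) (b : B) : P.incl b ∈ P.genAlg x s :=
  Algebra.subset_adjoin (Or.inl ⟨b, rfl⟩)

theorem mem_genAlg {s : Set I} {i : I} (hi : i ∈ s) : x i ∈ P.genAlg x s :=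
  Algebra.subset_adjoin (Or.inr ⟨i, hi, rfl⟩)

theorem genAlg_mono {s t : Set I} (h : s ⊆ t) : P.genAlg x s ≤ P.genAlg x t :=
  Algebra.adjoin_mono (Set.union_subset_union_right _ (Set.image_mono h))

/-- Reduces statements linear in an element of the generated algebra to words. Words are closed
under products because the coefficient between two of them can be absorbed. -/
theorem mem_span_of_mem_genAlg {s : Set I} {a : A} (ha : a ∈ P.genAlg x s) :
    a ∈ Submodule.span ℂ {w | ∃ b l, (∀ q ∈ l, q.1 ∈ s) ∧ P.incl b * P.evalWord x l = w} := by
  induction ha using Algebra.adjoin_induction with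
  | mem a ha =>
    refine Submodule.subset_span ?_
    rcases ha with ⟨b, rfl⟩ | ⟨i, hi, rfl⟩
    · exact ⟨b, [], by simp, by simp [evalWord_nil]⟩
    · exact ⟨1, [(i, 1)], by simpa using hi, by simp [evalWord_nil, evalWord_cons]⟩
  | algebraMap c =>
    refine Submodule.subset_span ⟨algebraMap ℂ B c, [], by simp, ?_⟩
    rw [evalWord_nil, mul_one]
    exact AlgHomClass.commutes P.incl c
  | add a b _ _ ha hb => exact Submodule.add_mem _ ha hb
  | mul a b _ _ ha hb =>
    have h := Submodule.mul_mem_mul ha hb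
    rw [Submodule.span_mul_span] at h
    refine Submodule.span_mono ?_ h
    rintro _ ⟨_, ⟨b, l, hl, rfl⟩, _, ⟨b', l', hl', rfl⟩, rfl⟩
    obtain ⟨c, l'', h1, h2⟩ := P.exists_evalWord_mul_incl x b l b'
    refine ⟨c, l'' ++ l', ?_, ?_⟩
    · intro q hq
      rcases List.mem_append.1 hq with hq | hq
      · have : q.1 ∈ l.map Prod.fst := h1 ▸ List.mem_map_of_mem hq
        obtain ⟨r, hr, hrq⟩ := List.mem_map.1 this
        rw [← hrq]
        exact hl r hr
      · exact hl' q hq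
    · simp only [evalWord_append, ← mul_assoc]
      rw [← h2]

variable {P x} [LinearOrder I]

/-- The defining property in list form, with the product split at the peak. -/
theorem MonotoneIndep.E_list (hx : P.MonotoneIndep x) (L₁ L₂ : List (I × A)) (q : I × A)
    (hL : ∀ e ∈ L₁ ++ q :: L₂, e.2 ∈ P.eval (x e.1) '' NCPoly.noFreeTerm B)
    (hc : (L₁ ++ q :: L₂).IsChain (fun e e' => e.1 ≠ e'.1))
    (h₁ : ∀ i ∈ L₁.getLast?.map Prod.fst, i < q.1) (h₂ : ∀ i ∈ L₂.head?.map Prod.fst, i < q.1) :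
    P.E ((L₁.map Prod.snd).prod * q.2 * (L₂.map Prod.snd).prod) =
      P.E ((L₁.map Prod.snd).prod * P.incl (P.E q.2) * (L₂.map Prod.snd).prod) := by
  set L := L₁ ++ q :: L₂ with hLdef
  have hlen : L₁.length < L.length := by simp [hLdef]
  have hget : L[L₁.length] = q := by simp [hLdef]
  have key := hx L.length (fun k => L[k].1) (fun k => L[k].2)
    (fun l => hL _ (List.getElem_mem _)) ?_ ⟨L₁.length, hlen⟩ ?_
  · have e1 : List.ofFn (fun k : Fin L.length => L[k].2) = L.map Prod.snd := by
      refine List.ext_getElem (by simp) fun i h1 h2 => ?_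
      simp
    have e2 : List.ofFn (Function.update (fun k : Fin L.length => L[k].2) ⟨L₁.length, hlen⟩
        (P.incl (P.E q.2))) = L₁.map Prod.snd ++ P.incl (P.E q.2) :: L₂.map Prod.snd := by
      refine List.ext_getElem (by simp [hLdef, add_assoc]) fun i h1 h2 => ?_
      rw [List.getElem_ofFn, Function.update_apply]
      split_ifs with h
      · have : i = L₁.length := congrArg Fin.val h
        subst this
        simp
      · have hi : i ≠ L₁.length := fun h' => h (Fin.ext h')
        simp only [hLdef, Fin.getElem_fin]
        rcases Nat.lt_or_gt_of_ne hi with hi | hi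
        · rw [List.getElem_append_left hi, List.getElem_append_left (by simpa using hi),
            List.getElem_map]
        · rw [List.getElem_append_right hi.le, List.getElem_append_right (by simpa using hi.le)]
          simp only [List.length_map]
          obtain ⟨k, hk⟩ : ∃ k, i - L₁.length = k + 1 := ⟨i - L₁.length - 1, by omega⟩
          simp only [hk, List.getElem_cons_succ, List.getElem_map]
    have hE : P.E (L[(⟨L₁.length, hlen⟩ : Fin L.length)]).2 = P.E q.2 := by
      rw [Fin.getElem_fin, hget]
    rw [hE, e1, e2, hLdef] at key
    simpa [mul_assoc] using key
  · intro k l hkl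
    have := (List.isChain_iff_getElem.1 hc) k (by have := l.2; omega)
    intro h
    apply this
    simp only [Fin.getElem_fin] at h
    rw [h]
    simp only [hkl]
  · rintro l (h | h)
    · have hl : (l : ℕ) < L₁.length := by have : (l : ℕ) + 1 = L₁.length := h; omega
      have h' : (l : ℕ) = L₁.length - 1 := by have : (l : ℕ) + 1 = L₁.length := h; omega
      simp only [Fin.getElem_fin, hget]
      apply h₁
      rw [List.getLast?_eq_getElem?, ← h', List.getElem?_eq_getElem hl]
      simp [hLdef, List.getElem_append_left hl]
    · have h' : (l : ℕ) = L₁.length + 1 := h.symm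
      simp only [Fin.getElem_fin, hget]
      apply h₂
      have hl := l.2
      simp only [hLdef, List.length_append, List.length_cons, h'] at hl
      have hl2 : 0 < L₂.length := by omega
      rw [List.head?_eq_getElem?, List.getElem?_eq_getElem hl2]
      simp [hLdef, h']

/-- A factor with a locally maximal index may be replaced by its expectation. -/
theorem MonotoneIndep.E_peak (hx : P.MonotoneIndep x) (b : B) (l₁ l₂ : List (I × B)) {i : I} {a : A}
    (ha : a ∈ P.eval (x i) '' NCPoly.noFreeTerm B)
    (h₁ : ∀ j ∈ l₁.getLast?.map Prod.fst, j < i) (h₂ : ∀ j ∈ l₂.head?.map Prod.fst, j < i) :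
    P.E (P.incl b * P.evalWord x l₁ * a * P.evalWord x l₂) =
      P.E (P.incl b * P.evalWord x l₁ * P.incl (P.E a) * P.evalWord x l₂) := by
  obtain ⟨L₁, hL₁, hc₁, -, hg₁, hp₁⟩ := P.exists_alternating x 1 l₁
  obtain ⟨L₂, hL₂, hc₂, hh₂, -, hp₂⟩ := P.exists_alternating x 1 l₂
  have hp₁' : (L₁.map Prod.snd).prod = P.evalWord x l₁ := by
    rcases eq_or_ne l₁ [] with rfl | h
    · have : L₁ = [] := by simpa using hg₁
      subst this; rfl
    · simpa using hp₁ h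
  have hp₂' : (L₂.map Prod.snd).prod = P.evalWord x l₂ := by
    rcases eq_or_ne l₂ [] with rfl | h
    · have : L₂ = [] := by simpa using hh₂
      subst this; rfl
    · simpa using hp₂ h
  rw [← hg₁] at h₁
  rw [← hh₂] at h₂
  have key := hx.E_list L₁ L₂ (i, a) ?_ ?_ h₁ h₂
  · rw [hp₁', hp₂'] at key
    simp only [mul_assoc, E_incl_mul] at key ⊢
    rw [key]
  · intro e he
    rcases List.mem_append.1 he with he | he
    · exact hL₁ e he
    · rcases List.mem_cons.1 he with rfl | he
      · exact ha
      · exact hL₂ e he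
  · rw [List.isChain_append]
    refine ⟨hc₁, ?_, ?_⟩
    · rw [List.isChain_cons]
      refine ⟨fun e he => (h₂ e.1 ?_).ne', hc₂⟩
      exact Option.mem_map_of_mem Prod.fst he
    · intro e he e' he'
      simp only [List.head?_cons, Option.mem_def, Option.some.injEq] at he'
      subst he'
      exact (h₁ e.1 (Option.mem_map_of_mem Prod.fst he)).ne

/-- A word in letters with indices `≥ K`, isolated by letters with indices `< K`, may be replaced
by its expectation. -/
theorem MonotoneIndep.E_word (hx : P.MonotoneIndep x) (K : I) (n : ℕ) :
    ∀ (l : List (I × B)), l.length = n → (∀ q ∈ l, K ≤ q.1) → ∀ (b₀ b : B) (l₁ l₂ : List (I × B)),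
    (∀ j ∈ l₁.getLast?.map Prod.fst, j < K) → (∀ j ∈ l₂.head?.map Prod.fst, j < K) →
    P.E (P.incl b₀ * P.evalWord x l₁ * (P.incl b * P.evalWord x l) * P.evalWord x l₂) =
      P.E (P.incl b₀ * P.evalWord x l₁ * P.incl (P.E (P.incl b * P.evalWord x l)) *
        P.evalWord x l₂) := by
  induction n using Nat.strong_induction_on with
  | _ n ih =>
  intro l hln hK b₀ b l₁ l₂ h₁ h₂
  rcases eq_or_ne l [] with rfl | hl
  · rw [evalWord_nil, mul_one, P.E_incl]
  -- Strong induction on the length: take the largest index `m` of the word and its first maximal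
  -- run, so that `l = lA ++ run ++ lB`. The run is a peak and can be replaced by its expectation,
  -- which is absorbed as a coefficient and leaves a shorter word.
  obtain ⟨m, hm, hmax⟩ : ∃ m ∈ l.map Prod.fst, ∀ q ∈ l, q.1 ≤ m := by
    have hne : (l.map Prod.fst).toFinset.Nonempty := by
      obtain ⟨q, l, rfl⟩ := List.exists_cons_of_ne_nil hl
      exact ⟨q.1, by simp⟩
    refine ⟨(l.map Prod.fst).toFinset.max' hne, ?_, fun q hq => ?_⟩
    · exact List.mem_toFinset.1 (Finset.max'_mem _ hne)
    · exact Finset.le_max' _ _ (List.mem_toFinset.2 (List.mem_map_of_mem hq))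
  have hKm : K ≤ m := by
    obtain ⟨q, hq, rfl⟩ := List.mem_map.1 hm
    exact hK q hq
  set lA := l.takeWhile (fun q => q.1 ≠ m) with hlA
  set rest := l.dropWhile (fun q => q.1 ≠ m) with hrest
  set run := rest.takeWhile (fun q => q.1 = m) with hrun
  set lB := rest.dropWhile (fun q => q.1 = m) with hlB
  have hsplit : l = lA ++ (run ++ lB) := by
    rw [hrun, hlB, List.takeWhile_append_dropWhile, hlA, hrest, List.takeWhile_append_dropWhile]
  have hrest_ne : rest ≠ [] := by
    intro h
    rw [hrest, List.dropWhile_eq_nil_iff] at h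
    obtain ⟨q, hq, rfl⟩ := List.mem_map.1 hm
    simpa using h q hq
  have hrun_ne : run ≠ [] := by
    have hhead := List.head_dropWhile_not (fun q : I × B => decide (q.1 ≠ m)) hrest_ne
    obtain ⟨q, r, hqr⟩ := List.exists_cons_of_ne_nil hrest_ne
    have hq : q.1 = m := by
      have : (l.dropWhile (fun q => decide (q.1 ≠ m))).head hrest_ne = q := by
        simp only [← hrest, hqr, List.head_cons]
      rw [this] at hhead
      simpa using hhead
    rw [hrun, hqr, List.takeWhile_cons_of_pos (by simpa using hq)]
    simp
  have hrun_m : ∀ q ∈ run, q.1 = m := fun q hq => by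
    simpa using List.mem_takeWhile_imp hq
  have hlA_m : ∀ q ∈ lA, q.1 < m := fun q hq => by
    have h1 : q.1 ≠ m := by simpa using List.mem_takeWhile_imp hq
    exact lt_of_le_of_ne (hmax q (by rw [hsplit]; exact List.mem_append_left _ hq)) h1
  have hlB_m : ∀ j ∈ lB.head?.map Prod.fst, j < m := by
    intro j hj
    obtain ⟨q, hq, rfl⟩ := Option.mem_map.1 hj
    have hne : lB ≠ [] := by rintro h; rw [h] at hq; simp at hq
    have hq' : lB.head hne = q := by
      rw [List.head?_eq_some_head hne] at hq
      simpa using hq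
    have hhead : decide ((lB.head hne).1 = m) = false :=
      List.head_dropWhile_not (fun q : I × B => decide (q.1 = m)) hne
    rw [hq'] at hhead
    have h1 : q.1 ≠ m := by simpa using hhead
    refine lt_of_le_of_ne (hmax q ?_) h1
    rw [hsplit]
    exact List.mem_append_right _ (List.mem_append_right _ (List.mem_of_mem_head? hq))
  have hrun_mem := P.evalWord_mem_image_noFreeTerm x hrun_ne hrun_m
  obtain ⟨b₀', l₁', hl₁', hmerge₁⟩ := P.exists_evalWord_mul_incl x b₀ l₁ b
  obtain ⟨b', lA', hlA', hmerge₂⟩ :=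
    P.exists_evalWord_mul_incl x b lA (P.E (P.evalWord x run))
  have hlast : ∀ j ∈ (l₁' ++ lA).getLast?.map Prod.fst, j < m := by
    intro j hj
    rw [List.getLast?_append, Option.map_or, ← List.getLast?_map, ← List.getLast?_map, hl₁'] at hj
    rcases eq_or_ne lA [] with h | h
    · rw [h] at hj
      simp only [List.map_nil, List.getLast?_nil, Option.none_or, List.getLast?_map] at hj
      exact (h₁ j hj).trans_le hKm
    · have : (lA.map Prod.fst).getLast? = some ((lA.map Prod.fst).getLast (by simpa using h)) :=
        List.getLast?_eq_some_getLast _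
      rw [this, Option.some_or, Option.mem_def, Option.some.injEq] at hj
      have hj' : j ∈ lA.map Prod.fst := hj ▸ List.getLast_mem _
      obtain ⟨q, hq, rfl⟩ := List.mem_map.1 hj'
      exact hlA_m q hq
  have hhead : ∀ j ∈ (lB ++ l₂).head?.map Prod.fst, j < m := by
    intro j hj
    rcases eq_or_ne lB [] with h | h
    · rw [h, List.nil_append] at hj
      exact (h₂ j hj).trans_le hKm
    · rw [List.head?_append_of_ne_nil _ h] at hj
      exact hlB_m j hj
  -- The run is replaced both in the whole product and in the inner word alone. Where the inner word
  -- ends at the run, the outer neighbour has index below `K ≤ m`.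
  have peak₁ := hx.E_peak b₀' (l₁' ++ lA) (lB ++ l₂) hrun_mem hlast hhead
  have peak₂ := hx.E_peak b lA lB hrun_mem
    (fun j hj => by
      obtain ⟨q, hq, rfl⟩ := Option.mem_map.1 hj
      exact hlA_m q (List.mem_of_getLast? hq)) hlB_m
  have hl' : ∀ q ∈ lA' ++ lB, K ≤ q.1 := by
    intro q hq
    rcases List.mem_append.1 hq with hq | hq
    · have : q.1 ∈ lA.map Prod.fst := hlA' ▸ List.mem_map_of_mem hq
      obtain ⟨r, hr, hrq⟩ := List.mem_map.1 this
      rw [← hrq]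
      exact hK r (by rw [hsplit]; exact List.mem_append_left _ hr)
    · exact hK q (by rw [hsplit]; exact List.mem_append_right _ (List.mem_append_right _ hq))
  have hlen : (lA' ++ lB).length < n := by
    have e1 : lA'.length = lA.length := by simpa using congrArg List.length hlA'
    have e2 : 0 < run.length := List.length_pos_iff.2 hrun_ne
    rw [← hln, hsplit]
    simp only [List.length_append, e1]
    omega
  have hI := ih _ hlen _ rfl hl' b₀ b' l₁ l₂ h₁ h₂
  rw [evalWord_append, ← mul_assoc (P.incl b'), ← hmerge₂, ← peak₂] at hI
  have e1 : P.incl b * P.evalWord x l =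
      P.incl b * P.evalWord x lA * P.evalWord x run * P.evalWord x lB := by
    rw [hsplit]
    simp only [evalWord_append, mul_assoc]
  rw [e1, ← hI]
  have e2 : ∀ c : A, P.incl b₀ * P.evalWord x l₁ * (P.incl b * P.evalWord x lA * c *
      P.evalWord x lB) * P.evalWord x l₂ =
      P.incl b₀' * P.evalWord x (l₁' ++ lA) * c * P.evalWord x (lB ++ l₂) := by
    intro c
    rw [evalWord_append, evalWord_append, ← mul_assoc (P.incl b₀'), ← hmerge₁]
    simp only [mul_assoc]
  rw [e2, e2, peak₁]

/-- Both sides are trilinear in `p`, `f`, `r`, which reduces the claim to the case of words,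
`E_word`. -/
theorem MonotoneIndep.E_mul_mul (hx : P.MonotoneIndep x) (K : I) {p f r : A}
    (hp : p ∈ Submodule.span ℂ {w | ∃ b l, (∀ j ∈ l.getLast?.map Prod.fst, j < K) ∧
      P.incl b * P.evalWord x l = w})
    (hf : f ∈ P.genAlg x (Set.Ici K))
    (hr : r ∈ Submodule.span ℂ {w | ∃ l, (∀ j ∈ l.head?.map Prod.fst, j < K) ∧
      P.evalWord x l = w}) :
    P.E (p * f * r) = P.E (p * P.incl (P.E f) * r) := by
  replace hf := P.mem_span_of_mem_genAlg x hf
  induction hp using Submodule.span_induction with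
  | zero => simp
  | add p p' _ _ h h' => simp only [add_mul, map_add, h, h']
  | smul c p _ h => simp only [smul_mul_assoc, map_smul, h]
  | mem p hp =>
  induction hr using Submodule.span_induction with
  | zero => simp
  | add p p' _ _ h h' => simp only [mul_add, map_add, h, h']
  | smul c p _ h => simp only [mul_smul_comm, map_smul, h]
  | mem r hr =>
  induction hf using Submodule.span_induction with
  | zero => simp
  | add p p' _ _ h h' => simp only [mul_add, add_mul, map_add, h, h']
  | smul c p _ h => simp only [mul_smul_comm, smul_mul_assoc, map_smul, h]
  | mem f hf =>
  obtain ⟨b₀, l₁, h₁, rfl⟩ := hp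
  obtain ⟨l₂, h₂, rfl⟩ := hr
  obtain ⟨b, l, hl, rfl⟩ := hf
  exact hx.E_word K _ l rfl hl b₀ b l₁ l₂ h₁ h₂

/-- Elements of the algebra generated by the variables of indices `≥ K`, isolated by a variable
`y` of lower indices, may be replaced by their expectations; here nothing stands on the left. -/
theorem MonotoneIndep.E_left (hx : P.MonotoneIndep x) (K : I) {y f s : A}
    (hy : y ∈ Submodule.span ℂ (x '' Set.Iio K)) (hf : f ∈ P.genAlg x (Set.Ici K))
    (hs : s ∈ P.genAlg x Set.univ) :
    P.E (f * (y * s)) = P.E (P.incl (P.E f) * (y * s)) := by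
  have h := hx.E_mul_mul K (p := 1) (f := f) (r := y * s)
    (Submodule.subset_span ⟨1, [], by simp, by simp [evalWord_nil]⟩) hf ?_
  · simpa using h
  · have h := Submodule.mul_mem_mul hy (P.mem_span_of_mem_genAlg x hs)
    rw [Submodule.span_mul_span] at h
    refine Submodule.span_mono ?_ h
    rintro _ ⟨_, ⟨i, hi, rfl⟩, _, ⟨b, l, hl, rfl⟩, rfl⟩
    exact ⟨(i, b) :: l, by simpa using hi, by simp [evalWord_cons, mul_assoc]⟩

theorem MonotoneIndep.mul_mem_span (K : I) {y p : A}
    (hy : y ∈ Submodule.span ℂ (x '' Set.Iio K)) (hp : p ∈ P.genAlg x Set.univ) :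
    p * y ∈ Submodule.span ℂ {w | ∃ b l, (∀ j ∈ l.getLast?.map Prod.fst, j < K) ∧
      P.incl b * P.evalWord x l = w} := by
  have h := Submodule.mul_mem_mul (P.mem_span_of_mem_genAlg x hp) hy
  rw [Submodule.span_mul_span] at h
  refine Submodule.span_mono ?_ h
  rintro _ ⟨_, ⟨b, l, hl, rfl⟩, _, ⟨i, hi, rfl⟩, rfl⟩
  exact ⟨b, l ++ [(i, 1)], by simpa using hi, by
    simp [evalWord_append, evalWord_cons, evalWord_nil, mul_assoc]⟩

/-- Together with `E_left` and `E_mid`, this supplies entrywise the replacement hypotheses of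
`map_wordProd_eq`. -/
theorem MonotoneIndep.E_right (hx : P.MonotoneIndep x) (K : I) {y p f : A}
    (hy : y ∈ Submodule.span ℂ (x '' Set.Iio K)) (hp : p ∈ P.genAlg x Set.univ)
    (hf : f ∈ P.genAlg x (Set.Ici K)) :
    P.E (p * y * f) = P.E (p * y * P.incl (P.E f)) := by
  have h := hx.E_mul_mul K (r := 1) (mul_mem_span K hy hp) hf
    (Submodule.subset_span ⟨[], by simp, by simp [evalWord_nil]⟩)
  simpa using h

theorem MonotoneIndep.E_mid (hx : P.MonotoneIndep x) (K : I) {y p f s : A}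
    (hy : y ∈ Submodule.span ℂ (x '' Set.Iio K)) (hp : p ∈ P.genAlg x Set.univ)
    (hf : f ∈ P.genAlg x (Set.Ici K)) (hs : s ∈ P.genAlg x Set.univ) :
    P.E (p * y * f * (y * s)) = P.E (p * y * P.incl (P.E f) * (y * s)) := by
  refine hx.E_mul_mul K (mul_mem_span K hy hp) hf ?_
  have h := Submodule.mul_mem_mul hy (P.mem_span_of_mem_genAlg x hs)
  rw [Submodule.span_mul_span] at h
  refine Submodule.span_mono ?_ h
  rintro _ ⟨_, ⟨i, hi, rfl⟩, _, ⟨b, l, hl, rfl⟩, rfl⟩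
  exact ⟨(i, b) :: l, by simpa using hi, by simp [evalWord_cons, mul_assoc]⟩

end BProbSpace

end

/-! ### Contractivity of the conditional expectation on matrices -/

noncomputable section

namespace BProbSpace

variable {B A : Type*} [CStarAlgebra B] [PartialOrder B] [StarOrderedRing B] [CStarAlgebra A]
  (P : BProbSpace B A)

/-- Positivity at `1 + c`, `c` and `1` shows that `E(c) + E(c*)` is self-adjoint; the choices `c =
a` and `c = i a` together give the claim. -/
theorem E_star (a : A) : P.E (star a) = star (P.E a) := by
  have h : ∀ c : A, P.E c + P.E (star c) = star (P.E c) + star (P.E (star c)) := by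
    intro c
    have h1 := (IsSelfAdjoint.of_nonneg (P.E_pos (1 + c))).star_eq
    have h2 := (IsSelfAdjoint.of_nonneg (P.E_pos c)).star_eq
    have h3 := (IsSelfAdjoint.of_nonneg (P.E_pos 1)).star_eq
    have e : star (1 + c) * (1 + c) = star (1 : A) * 1 + c + star c + star c * c := by
      simp [add_mul, mul_add, star_add]; abel
    rw [e] at h1
    simp only [map_add, star_add, h2, h3] at h1
    have h1 := add_right_cancel h1
    rw [add_assoc, add_assoc] at h1
    exact (add_left_cancel h1).symm
  have h1 := h a
  have h2 := h (Complex.I • a)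
  simp only [star_smul, map_smul, map_neg, star_neg, RCLike.star_def, Complex.conj_I, neg_smul,
    neg_neg] at h2
  have h4 : P.E a + -P.E (star a) = -star (P.E a) + star (P.E (star a)) := by
    have := congrArg (fun t => (-Complex.I) • t) h2
    simp only [smul_add, smul_neg, smul_smul] at this
    simpa using this
  have h5 : (2 : ℂ) • P.E (star a) = (2 : ℂ) • star (P.E a) := by
    rw [two_smul, two_smul]
    have := congrArg₂ (· - ·) h1 h4
    abel_nf at this ⊢
    simpa using this
  simpa using congrArg (fun t => (2 : ℂ)⁻¹ • t) h5

theorem E_nonneg [PartialOrder A] [StarOrderedRing A] {a : A} (ha : 0 ≤ a) : 0 ≤ P.E a := by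
  obtain ⟨c, rfl⟩ := CStarAlgebra.nonneg_iff_eq_star_mul_self.1 ha
  exact P.E_pos c

/-- Positivity at `a - E(a)` yields the Schwarz inequality `E(a)* E(a) ≤ E(a* a)`, and `a* a ≤ ‖a‖²`
bounds the right side. -/
theorem norm_E_le (a : A) : ‖P.E a‖ ≤ ‖a‖ := by
  let _ := CStarAlgebra.spectralOrder A
  have := CStarAlgebra.spectralOrderedRing A
  have h1 : star (P.E a) * P.E a ≤ P.E (star a * a) := by
    have h := P.E_pos (a - P.incl (P.E a))
    have e : star (a - P.incl (P.E a)) * (a - P.incl (P.E a)) =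
        star a * a - star a * P.incl (P.E a) - P.incl (star (P.E a)) * a +
          P.incl (star (P.E a) * P.E a) := by
      simp only [star_sub, map_star, map_mul]
      noncomm_ring
    rw [e] at h
    simp only [map_add, map_sub, E_mul_incl, E_incl_mul, E_incl, E_star] at h
    simpa using h
  have h2 : P.E (star a * a) ≤ algebraMap ℝ B (‖a‖ ^ 2) := by
    have h := P.E_nonneg (sub_nonneg.2 (CStarAlgebra.star_mul_le_algebraMap_norm_sq (a := a)))
    have e : P.E (algebraMap ℝ A (‖a‖ ^ 2)) = algebraMap ℝ B (‖a‖ ^ 2) := by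
      have e1 := P.E_incl 1
      rw [map_one] at e1
      rw [IsScalarTower.algebraMap_apply ℝ ℂ A, IsScalarTower.algebraMap_apply ℝ ℂ B,
        Algebra.algebraMap_eq_smul_one (A := A), Algebra.algebraMap_eq_smul_one (A := B),
        map_smul, e1]
    rw [map_sub, e] at h
    exact sub_nonneg.1 h
  have h3 := (CStarAlgebra.norm_le_iff_le_algebraMap _ (by positivity)
    (star_mul_self_nonneg (P.E a))).2 (h1.trans h2)
  rw [CStarRing.norm_star_mul_self, ← sq] at h3
  exact (sq_le_sq₀ (norm_nonneg _) (norm_nonneg _)).1 h3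

end BProbSpace

namespace CStarMatrix

variable {m : ℕ} {R S : Type*} [Ring R] [Ring S]

/-- The scalar matrix with diagonal entries `a`. -/
def scalarMat (m : ℕ) (a : R) : CStarMatrix (Fin m) (Fin m) R :=
  ofMatrix (Matrix.diagonal fun _ => a)

theorem scalarMat_mul_apply (a : R) (M : CStarMatrix (Fin m) (Fin m) R) (i j : Fin m) :
    (scalarMat m a * M) i j = a * M i j := Matrix.diagonal_mul _ _ _ _

theorem mul_scalarMat_apply (a : R) (M : CStarMatrix (Fin m) (Fin m) R) (i j : Fin m) :
    (M * scalarMat m a) i j = M i j * a := Matrix.mul_diagonal _ _ _ _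

theorem scalarMat_add (a b : R) : scalarMat m (a + b) = scalarMat m a + scalarMat m b :=
  congrArg ofMatrix (Matrix.diagonal_add (fun _ : Fin m => a) (fun _ => b)).symm

/-- Entrywise application of a ring homomorphism. -/
def mapHom (f : R →+* S) : CStarMatrix (Fin m) (Fin m) R →+* CStarMatrix (Fin m) (Fin m) S where
  toFun M := M.map f
  map_one' := by
    ext i j
    rw [map_apply, one_apply, one_apply]
    split_ifs <;> simp
  map_mul' M N := by ext i j; simp [mul_apply]
  map_zero' := by ext; simp
  map_add' M N := by ext; simp

theorem mapHom_apply (f : R →+* S) (M : CStarMatrix (Fin m) (Fin m) R) :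
    mapHom f M = M.map f := rfl

/-- Scalar matrices, as a homomorphism of ⋆-algebras. -/
def scalarMatHom (m : ℕ) (A : Type*) [CStarAlgebra A] :
    A →⋆ₙₐ[ℂ] CStarMatrix (Fin m) (Fin m) A where
  toFun := scalarMat m
  map_smul' c a := by
    ext i j
    simp only [scalarMat, smul_apply, ofMatrix_apply, Matrix.diagonal_apply]
    split_ifs <;> simp
  map_zero' := by
    ext i j
    simp [scalarMat]
  map_add' a b := scalarMat_add a b
  map_mul' a b := by
    ext i j
    rw [scalarMat_mul_apply]
    simp only [scalarMat, ofMatrix_apply, Matrix.diagonal_apply]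
    split_ifs <;> simp
  map_star' a := by
    ext i j
    rw [star_apply]
    simp only [scalarMat, ofMatrix_apply, Matrix.diagonal_apply]
    by_cases h : i = j
    · simp [h]
    · simp [h, Ne.symm h]

theorem norm_scalarMat_le (m : ℕ) {A : Type*} [CStarAlgebra A] [PartialOrder A]
    [StarOrderedRing A] (a : A) : ‖scalarMat m a‖ ≤ ‖a‖ :=
  NonUnitalStarAlgHom.norm_apply_le (scalarMatHom m A) a

end CStarMatrix

namespace BProbSpace

open CStarMatrix WithCStarModule

variable {B A : Type*} [CStarAlgebra B] [PartialOrder B] [StarOrderedRing B] [CStarAlgebra A]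
  [PartialOrder A] [StarOrderedRing A] (P : BProbSpace B A) {m : ℕ}

theorem norm_map_incl_le (M : CStarMatrix (Fin m) (Fin m) B) : ‖M.map P.incl‖ ≤ ‖M‖ :=
  NonUnitalStarAlgHom.norm_apply_le (mapₙₐ (n := Fin m) (P.incl : B →⋆ₙₐ[ℂ] A)) M

open scoped InnerProductSpace in
-- The matrix norm is tested on vectors of the Hilbert modules. By the bimodule property `⟪w, E(M)
-- v⟫` is `E` of the inner product over `A` with the included vectors, so the bound for single
-- elements and Cauchy–Schwarz suffice for every `m`.
theorem norm_map_E_le (M : CStarMatrix (Fin m) (Fin m) A) : ‖M.map P.E‖ ≤ ‖M‖ := by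
  refine norm_le_of_forall_inner_le (C := ‖M‖₊) fun v w => ?_
  let up : C⋆ᵐᵒᵈ(B, Fin m → B) → C⋆ᵐᵒᵈ(A, Fin m → A) := fun v =>
    (WithCStarModule.equiv _ _).symm fun i => P.incl (v i)
  have hup : ∀ v, ‖up v‖ ≤ ‖v‖ := by
    intro v
    rw [pi_norm, pi_norm]
    apply Real.sqrt_le_sqrt
    have : ∑ i, ⟪up v i, up v i⟫_A = P.incl (∑ i, ⟪v i, v i⟫_B) := by
      simp [up, inner_def, map_sum, map_star]
    rw [this]
    exact NonUnitalStarAlgHom.norm_apply_le P.incl _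
  have h : ⟪w, toCLM (M.map P.E) v⟫_B = P.E ⟪up w, toCLM M (up v)⟫_A := by
    simp only [toCLM_apply_eq_sum, pi_inner, equiv_symm_pi_apply, inner_def, up, map_sum,
      Finset.sum_mul, map_apply]
    refine Finset.sum_congr rfl fun j _ => Finset.sum_congr rfl fun i _ => ?_
    rw [← map_star, E_bimodule]
  rw [h]
  calc _ ≤ _ := P.norm_E_le _
    _ ≤ ‖up w‖ * ‖toCLM M (up v)‖ := CStarModule.norm_inner_le _
    _ ≤ ‖w‖ * (‖M‖ * ‖v‖) := by
      gcongr
      · exact hup w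
      · refine ((toCLM M).le_opNorm _).trans ?_
        rw [norm_def]
        gcongr
        exact hup v
    _ = _ := by rw [coe_nnnorm]; ring

end BProbSpace
end

/-! ### The moment series of an element and its behaviour under monotone sums -/

noncomputable section

open CStarMatrix

/-- The matrix `b₀ 𝒳 b₁ 𝒳 ⋯ 𝒳 bₙ` over `B⟨𝒳⟩`. -/
def polyWord {B : Type*} [CStarAlgebra B] {m : ℕ} :
    List (CStarMatrix (Fin m) (Fin m) B) → CStarMatrix (Fin m) (Fin m) (NCPoly B)
  | [] => 1
  | b :: l => b.map (NCPoly.C B) * (l.map xMul).prod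

namespace BProbSpace

variable {B A : Type*} [CStarAlgebra B] [PartialOrder B] [StarOrderedRing B] [CStarAlgebra A]
  (P : BProbSpace B A)

/-- The word `b₀ x b₁ x ⋯ x bₙ` with matrix coefficients. -/
theorem polyWord_map_eval (x : A) {m : ℕ} (l : List (CStarMatrix (Fin m) (Fin m) B)) :
    (polyWord l).map (P.eval x) = wordProd (scalarMat m x) (l.map fun b => b.map P.incl) := by
  change mapHom (P.eval x : NCPoly B →+* A) (polyWord l) = _
  cases l with
  | nil => simp [polyWord, wordProd]
  | cons b l =>
    simp only [polyWord, wordProd, List.map_cons, map_mul, map_list_prod, List.map_map]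
    congr 1
    · ext i j
      exact P.eval_C x _
    · congr 2
      funext c
      ext i j
      simp only [Function.comp_apply, scalarMat_mul_apply, mapHom_apply, map_apply, xMul]
      change P.eval x (NCPoly.X B * NCPoly.C B (c i j)) = _
      rw [map_mul, eval_X, eval_C]

theorem map_E_map_incl_mul {m : ℕ} (b : CStarMatrix (Fin m) (Fin m) B)
    (M : CStarMatrix (Fin m) (Fin m) A) : (b.map P.incl * M).map P.E = b * M.map P.E := by
  ext i j
  simp [mul_apply, E_incl_mul]

theorem map_E_mul_map_incl {m : ℕ} (b : CStarMatrix (Fin m) (Fin m) B)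
    (M : CStarMatrix (Fin m) (Fin m) A) : (M * b.map P.incl).map P.E = M.map P.E * b := by
  ext i j
  simp [mul_apply, E_mul_incl]

variable [PartialOrder A] [StarOrderedRing A]

/-- Entrywise application of the inclusion, as a continuous linear map. -/
def inclCLM (m : ℕ) : CStarMatrix (Fin m) (Fin m) B →L[ℂ] CStarMatrix (Fin m) (Fin m) A :=
  LinearMap.mkContinuous (mapₗ (P.incl.toAlgHom.toLinearMap)) 1 fun M => by
    rw [one_mul]; exact P.norm_map_incl_le M

/-- Entrywise application of the conditional expectation, as a continuous linear map. -/
def expCLM (m : ℕ) : CStarMatrix (Fin m) (Fin m) A →L[ℂ] CStarMatrix (Fin m) (Fin m) B :=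
  LinearMap.mkContinuous (mapₗ P.E) 1 fun M => by
    rw [one_mul]; exact P.norm_map_E_le M

theorem expCLM_apply (m : ℕ) (M : CStarMatrix (Fin m) (Fin m) A) :
    P.expCLM m M = M.map P.E := rfl

/-- The moment series of `x` on matrices: its `(n + 1)`-st term is
`(b₀, …, bₙ) ↦ E(b₀ x b₁ x ⋯ x bₙ)`. -/
def momentFMS (m : ℕ) (x : A) : FormalMultilinearSeries ℂ (CStarMatrix (Fin m) (Fin m) B)
    (CStarMatrix (Fin m) (Fin m) B)
  | 0 => 0
  | n + 1 => (P.expCLM m).compContinuousMultilinearMap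
      ((ContinuousMultilinearMap.mkPiAlgebraFin ℂ (n + 1)
        (CStarMatrix (Fin m) (Fin m) A)).compContinuousLinearMap fun i =>
        if i = 0 then P.inclCLM m else
          (ContinuousLinearMap.mul ℂ (CStarMatrix (Fin m) (Fin m) A) (scalarMat m x)).comp
            (P.inclCLM m))

theorem momentFMS_zero (m : ℕ) (x : A) : P.momentFMS m x 0 = 0 := rfl

theorem momentFMS_apply (m : ℕ) (x : A) {n : ℕ} (hn : n ≠ 0)
    (v : Fin n → CStarMatrix (Fin m) (Fin m) B) :
    P.momentFMS m x n v =
      (wordProd (scalarMat m x) ((List.ofFn v).map fun b => b.map P.incl)).map P.E := by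
  obtain ⟨n, rfl⟩ := Nat.exists_eq_succ_of_ne_zero hn
  simp only [Nat.succ_eq_add_one, momentFMS,
    ContinuousLinearMap.compContinuousMultilinearMap_coe, Function.comp_apply,
    ContinuousMultilinearMap.compContinuousLinearMap_apply,
    ContinuousMultilinearMap.mkPiAlgebraFin_apply, expCLM_apply]
  congr 1
  rw [List.ofFn_succ, List.ofFn_succ, List.prod_cons, List.map_cons, wordProd]
  congr 2
  rw [List.map_map, List.map_ofFn]
  congr 1

theorem momentFMS_apply_law (m : ℕ) (x : A) {n : ℕ} (hn : n ≠ 0)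
    (v : Fin n → CStarMatrix (Fin m) (Fin m) B) :
    P.momentFMS m x n v = (polyWord (List.ofFn v)).map (P.law x) := by
  rw [momentFMS_apply _ _ _ hn, ← polyWord_map_eval]
  rfl

theorem momentFMS_congr {m : ℕ} {x y : A} (h : P.law x = P.law y) :
    P.momentFMS m x = P.momentFMS m y := by
  ext n v
  rcases eq_or_ne n 0 with rfl | hn
  · rfl
  · rw [momentFMS_apply_law _ _ _ hn, momentFMS_apply_law _ _ _ hn, h]

theorem momentFMS_one (m : ℕ) (x : A) (v : Fin 1 → CStarMatrix (Fin m) (Fin m) B) :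
    P.momentFMS m x 1 v = v 0 := by
  rw [momentFMS_apply _ _ _ one_ne_zero]
  ext i j
  simp [wordProd, P.E_incl]

/-- This coefficient is `b₀ E(x) b₁`; centering enters the argument here. -/
theorem momentFMS_two {x : A} (hx : P.E x = 0) (m : ℕ) : P.momentFMS m x 2 = 0 := by
  ext v : 1
  rw [momentFMS_apply _ _ _ two_ne_zero]
  simp only [List.ofFn_succ, List.ofFn_zero, List.map_cons, List.map_nil, wordProd,
    List.prod_cons, List.prod_nil, mul_one]
  have : (scalarMat m x).map P.E = 0 := by
    ext i j
    simp only [scalarMat, map_apply, ofMatrix_apply, Matrix.diagonal_apply]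
    split_ifs <;> simp [hx]
  rw [map_E_map_incl_mul, map_E_mul_map_incl, this, zero_mul, mul_zero]
  rfl

/-- The bound does not involve `m`, which makes the final radius and growth constant the same for
all matrix sizes. -/
theorem norm_momentFMS_three_le (m : ℕ) (x : A) : ‖P.momentFMS m x 3‖ ≤ ‖x‖ ^ 2 := by
  refine ContinuousMultilinearMap.opNorm_le_bound (by positivity) fun v => ?_
  rw [momentFMS_apply _ _ _ three_ne_zero]
  refine (P.norm_map_E_le _).trans ?_
  simp only [List.ofFn_succ, List.ofFn_zero, List.map_cons, List.map_nil, wordProd,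
    List.prod_cons, List.prod_nil, mul_one, Fin.prod_univ_succ, Fin.prod_univ_zero]
  have hx := norm_scalarMat_le m x
  calc _ ≤ ‖(v 0).map P.incl‖ * ((‖scalarMat m x‖ * ‖(v 1).map P.incl‖) *
        (‖scalarMat m x‖ * ‖(v 2).map P.incl‖)) := by
        refine (norm_mul_le _ _).trans ?_
        gcongr
        refine (norm_mul_le _ _).trans ?_
        gcongr
        · exact norm_mul_le _ _
        · exact norm_mul_le _ _
    _ ≤ ‖v 0‖ * ((‖x‖ * ‖v 1‖) * (‖x‖ * ‖v 2‖)) := by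
        gcongr <;> exact P.norm_map_incl_le _
    _ = ‖x‖ ^ 2 * (‖v 0‖ * (‖v 1‖ * ‖v 2‖)) := by ring

theorem momentFMS_of_zero (m : ℕ) :
    P.momentFMS m (0 : A) = FormalMultilinearSeries.id ℂ _ 0 := by
  ext n v : 2
  match n with
  | 0 => rfl
  | 1 => rw [momentFMS_one, FormalMultilinearSeries.id_apply_one]
  | n + 2 =>
    rw [momentFMS_apply _ _ _ (by omega),
      FormalMultilinearSeries.id_apply_of_one_lt _ _ _ (by omega)]
    have : scalarMat m (0 : A) = 0 := by ext i j; simp [scalarMat]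
    rw [this, List.ofFn_succ, List.ofFn_succ]
    ext i j
    simp [wordProd]

theorem momentFMS_smul (m : ℕ) (c : ℂ) (x : A) :
    P.momentFMS m (c • x) = (P.momentFMS m x).dil c := by
  ext n v : 2
  rcases eq_or_ne n 0 with rfl | hn
  · simp [FormalMultilinearSeries.dil, momentFMS_zero]
  · rw [FormalMultilinearSeries.dil, _root_.smul_apply, momentFMS_apply _ _ _ hn,
      momentFMS_apply _ _ _ hn]
    obtain ⟨n, rfl⟩ := Nat.exists_eq_succ_of_ne_zero hn
    have hs : scalarMat m (c • x) = c • scalarMat m x := map_smul (scalarMatHom m A) c x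
    have key : ∀ l : List (CStarMatrix (Fin m) (Fin m) A),
        (l.map (scalarMat m (c • x) * ·)).prod =
          c ^ l.length • (l.map (scalarMat m x * ·)).prod := by
      intro l
      induction l with
      | nil => simp
      | cons a l ih =>
        rw [List.map_cons, List.prod_cons, ih, hs, List.length_cons, List.map_cons,
          List.prod_cons, smul_mul_assoc, smul_mul_assoc, mul_smul_comm, smul_smul, pow_succ']
    rw [List.ofFn_succ, List.map_cons, wordProd, wordProd, key, mul_smul_comm]
    simp only [List.length_map, List.length_ofFn, Nat.succ_eq_add_one, Nat.add_sub_cancel]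
    exact map_smul (P.expCLM m) _ _

variable {P} {I : Type*} [LinearOrder I] {x : I → A}

/-- The moment series of a sum of monotone independent variables is the composition of their
moment series. -/
theorem MonotoneIndep.momentFMS_add (hx : P.MonotoneIndep x) (K : I) {y z : A}
    (hy : y ∈ Submodule.span ℂ (x '' Set.Iio K)) (hz : z ∈ P.genAlg x (Set.Ici K)) (m : ℕ) :
    P.momentFMS m (y + z) = (P.momentFMS m y).comp (P.momentFMS m z) := by
  have hyU : y ∈ P.genAlg x Set.univ := by
    have : Submodule.span ℂ (x '' Set.Iio K) ≤ Subalgebra.toSubmodule (P.genAlg x Set.univ) := by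
      rw [Submodule.span_le]
      rintro _ ⟨i, -, rfl⟩
      exact P.mem_genAlg x (Set.mem_univ i)
    exact this hy
  have hmulmem : ∀ (s : Set I) (M N : CStarMatrix (Fin m) (Fin m) A),
      (∀ i j, M i j ∈ P.genAlg x s) → (∀ i j, N i j ∈ P.genAlg x s) →
      ∀ i j, (M * N) i j ∈ P.genAlg x s := fun s M N hM hN i j => by
    rw [mul_apply]
    exact Subalgebra.sum_mem _ fun k _ => Subalgebra.mul_mem _ (hM i k) (hN k j)
  have hone : ∀ (s : Set I) (i j : Fin m),
      (1 : CStarMatrix (Fin m) (Fin m) A) i j ∈ P.genAlg x s := fun s i j => by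
    rw [one_apply]
    split_ifs
    · exact Subalgebra.one_mem _
    · exact Subalgebra.zero_mem _
  have hscal : ∀ (s : Set I) (a : A), a ∈ P.genAlg x s → ∀ i j : Fin m,
      scalarMat m a i j ∈ P.genAlg x s := fun s a ha i j => by
    simp only [scalarMat, ofMatrix_apply, Matrix.diagonal_apply]
    split_ifs
    · exact ha
    · exact Subalgebra.zero_mem _
  let S : Submonoid (CStarMatrix (Fin m) (Fin m) A) :=
    { carrier := {M | ∀ i j, M i j ∈ P.genAlg x Set.univ}
      mul_mem' := fun {M N} hM hN => hmulmem _ M N hM hN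
      one_mem' := hone _ }
  let Z : Submonoid (CStarMatrix (Fin m) (Fin m) A) :=
    { carrier := {M | ∀ i j, M i j ∈ P.genAlg x (Set.Ici K)}
      mul_mem' := fun {M N} hM hN => hmulmem _ M N hM hN
      one_mem' := hone _ }
  let Φ : CStarMatrix (Fin m) (Fin m) A → CStarMatrix (Fin m) (Fin m) B := fun M => M.map P.E
  let Θ : CStarMatrix (Fin m) (Fin m) A → CStarMatrix (Fin m) (Fin m) A :=
    fun M => (M.map P.E).map P.incl
  -- Entries of matrix products are sums of products of entries, so the scalar replacement rules
  -- apply under each sum.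
  have hword : ∀ L : List (CStarMatrix (Fin m) (Fin m) A), (∀ f ∈ L, f ∈ Z) →
      Φ (wordProd (scalarMat m y) L) = Φ (wordProd (scalarMat m y) (L.map Θ)) := by
    refine map_wordProd_eq Φ Θ (scalarMat m y) S Z (hscal _ _ hyU)
      (fun M hM i j => P.genAlg_mono x (Set.subset_univ _) (hM i j))
      (fun M _ i j => P.incl_mem_genAlg x _ _) ?_ ?_
    · rintro f hf r (rfl | ⟨s, hs, rfl⟩)
      · ext i j
        simp [Φ, Θ, P.E_incl]
      · ext i k
        simp only [Φ, map_apply, mul_apply (M := f), mul_apply (M := Θ f), map_sum,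
          scalarMat_mul_apply]
        exact Finset.sum_congr rfl fun j _ => hx.E_left K hy (hf i j) (hs j k)
    · rintro p hp f hf r (rfl | ⟨s, hs, rfl⟩)
      · ext i k
        simp only [Φ, mul_one, map_apply, mul_apply (N := f), mul_apply (N := Θ f), map_sum,
          mul_scalarMat_apply]
        exact Finset.sum_congr rfl fun j _ => hx.E_right K hy (hp i j) (hf j k)
      · ext i k
        simp only [Φ, map_apply, mul_apply (N := scalarMat m y * s), mul_apply (N := f),
          mul_apply (N := Θ f), map_sum, Finset.sum_mul, mul_scalarMat_apply,
          scalarMat_mul_apply]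
        exact Finset.sum_congr rfl fun c _ => Finset.sum_congr rfl fun d _ =>
          hx.E_mid K hy (hp i d) (hf d c) (hs c k)
  ext n v : 2
  rcases eq_or_ne n 0 with rfl | hn
  · rw [FormalMultilinearSeries.comp_coeff_zero'']
    rfl
  obtain ⟨n, rfl⟩ := Nat.exists_eq_succ_of_ne_zero hn
  -- The compositions indexing the expansion of the word in `y + z` also index the composed series,
  -- and the terms are matched one by one: replacing each `z`-subword by its expectation inserts the
  -- series of `z` into that of `y`.
  rw [momentFMS_apply _ _ _ hn, scalarMat_add, wordProd_add _ _ n _ (by simp)]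
  simp only [FormalMultilinearSeries.comp, _root_.sum_apply,
    FormalMultilinearSeries.compAlongComposition_apply]
  have hmap : ∀ M : CStarMatrix (Fin m) (Fin m) A, M.map P.E = P.expCLM m M := fun _ => rfl
  rw [hmap, map_sum]
  refine Finset.sum_congr rfl fun c _ => ?_
  have hc : c.length ≠ 0 := by rw [Ne, c.length_eq_zero]; omega
  rw [momentFMS_apply _ _ _ hc, List.map_ofFn, List.splitWrtComposition_ofFn, List.map_ofFn]
  refine (hword _ ?_).trans ?_
  · intro f hf
    obtain ⟨i, rfl⟩ := List.mem_ofFn.1 hf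
    have hl : ∀ l : List (CStarMatrix (Fin m) (Fin m) A), (∀ a ∈ l, a ∈ Z) →
        wordProd (scalarMat m z) l ∈ Z := by
      intro l hl
      cases l with
      | nil => exact Z.one_mem
      | cons a l =>
        refine Z.mul_mem (hl a List.mem_cons_self) (Z.list_prod_mem fun b hb => ?_)
        obtain ⟨d, hd, rfl⟩ := List.mem_map.1 hb
        exact Z.mul_mem (hscal _ _ hz) (hl d (List.mem_cons_of_mem _ hd))
    refine hl _ fun a ha => ?_
    obtain ⟨j, rfl⟩ := List.mem_ofFn.1 ha
    exact fun i j => P.incl_mem_genAlg x _ _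
  · refine congrArg (fun l => (wordProd (scalarMat m y) l).map P.E) ?_
    rw [List.map_ofFn, List.map_ofFn]
    congr 1
    funext i
    simp only [Function.comp_apply, Θ, FormalMultilinearSeries.applyComposition]
    rw [momentFMS_apply _ _ _ (by have := c.one_le_blocksFun i; omega), List.map_ofFn]
    rfl

/-- The newly added variable has the largest index, so its series enters as the inner factor, as in
the recursion of `compIter`. -/
theorem IsMonotoneIID.momentFMS_sum {x : ℕ → A} (hx : P.IsMonotoneIID x) (m N : ℕ) :
    P.momentFMS m (∑ i ∈ Finset.range N, x i) =
      FormalMultilinearSeries.compIter (P.momentFMS m (x 0)) N := by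
  induction N with
  | zero => rw [Finset.range_zero, Finset.sum_empty, momentFMS_of_zero]; rfl
  | succ N ih =>
    rw [Finset.sum_range_succ, hx.monotoneIndep.momentFMS_add N, ih,
      P.momentFMS_congr (hx.identDistrib N 0)]
    · rfl
    · exact Submodule.sum_mem _ fun i hi =>
        Submodule.subset_span ⟨i, Finset.mem_range.1 hi, rfl⟩
    · exact P.mem_genAlg x Set.self_mem_Ici

end BProbSpace

end

/-! ### Nilpotent matrices over the tensor algebra -/

noncomputable section

open CStarMatrix

/-- Contraction of the last tensor factor with a linear functional. -/
def TensorAlgebra.contractLast {V : Type*} [AddCommGroup V] [Module ℂ V] (ψ : V →ₗ[ℂ] ℂ) :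
    TensorAlgebra ℂ V →ₗ[ℂ] TensorAlgebra ℂ V :=
  Matrix.entryLinearMap ℂ (TensorAlgebra ℂ V) (0 : Fin 2) (1 : Fin 2) ∘ₗ
    (TensorAlgebra.lift ℂ (Matrix.singleLinearMap ℂ (0 : Fin 2) (0 : Fin 2) ∘ₗ TensorAlgebra.ι ℂ +
      Matrix.singleLinearMap ℂ (0 : Fin 2) (1 : Fin 2) ∘ₗ
        Algebra.linearMap ℂ (TensorAlgebra ℂ V) ∘ₗ ψ)).toLinearMap

/-- A vector `b` acts as the matrix with first row `(b, ψ b)` and second row zero. The image of `u`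
then has first column `(u, 0)`, so the upper right entry of the image of `u b` is `ψ(b) u`. -/
theorem TensorAlgebra.contractLast_mul_ι {V : Type*} [AddCommGroup V] [Module ℂ V]
    (ψ : V →ₗ[ℂ] ℂ) (u : TensorAlgebra ℂ V) (b : V) :
    contractLast ψ (u * TensorAlgebra.ι ℂ b) = ψ b • u := by
  set G := TensorAlgebra.lift ℂ (Matrix.singleLinearMap ℂ (0 : Fin 2) (0 : Fin 2) ∘ₗ
      TensorAlgebra.ι ℂ + Matrix.singleLinearMap ℂ (0 : Fin 2) (1 : Fin 2) ∘ₗ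
        Algebra.linearMap ℂ (TensorAlgebra ℂ V) ∘ₗ ψ) with hG
  have hι : ∀ b, G (TensorAlgebra.ι ℂ b) = Matrix.single 0 0 (TensorAlgebra.ι ℂ b) +
      Matrix.single 0 1 (algebraMap ℂ _ (ψ b)) := fun b => by
    rw [hG, TensorAlgebra.lift_ι_apply]; rfl
  have h0 : ∀ u, G u 0 0 = u ∧ G u 1 0 = 0 := by
    intro u
    induction u using TensorAlgebra.induction with
    | algebraMap r =>
      rw [AlgHom.commutes]
      simp [Matrix.algebraMap_matrix_apply]
    | ι x => rw [hι]; simp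
    | mul a b ha hb =>
      rw [map_mul]
      simp [Matrix.mul_apply, ha, hb]
    | add a b ha hb =>
      rw [map_add]
      simp [ha, hb]
  change G (u * TensorAlgebra.ι ℂ b) 0 1 = _
  rw [map_mul, hι]
  simp [Matrix.mul_apply, Matrix.single_apply, (h0 u).1, Algebra.smul_def]
  rw [← Algebra.commutes]

/-- The space of scalar matrices `ψ(T)`, where `ψ` runs over the linear functionals on `B`. -/
def functionalImages {V : Type*} [AddCommGroup V] [Module ℂ V] {m : ℕ}
    (T : CStarMatrix (Fin m) (Fin m) V) : Submodule ℂ (Matrix (Fin m) (Fin m) ℂ) :=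
  LinearMap.range
    ({ toFun := fun ψ => Matrix.of fun i j => ψ (T i j)
       map_add' := fun _ _ => rfl
       map_smul' := fun _ _ => rfl } : (V →ₗ[ℂ] ℂ) →ₗ[ℂ] Matrix (Fin m) (Fin m) ℂ)

section

variable {V : Type*} [AddCommGroup V] [Module ℂ V] {m : ℕ} (T : CStarMatrix (Fin m) (Fin m) V)

theorem of_mem_functionalImages (ψ : V →ₗ[ℂ] ℂ) :
    (Matrix.of fun i j => ψ (T i j)) ∈ functionalImages T := ⟨ψ, rfl⟩

/-- Contracting the tensor factors of the vanishing power one at a time, from the right, shows that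
all products `ψ₁(T) ⋯ ψᵣ(T)` of scalar matrices vanish. In `key`, `k` factors are contracted and `j`
remain. -/
theorem functionalImages_pow_eq_bot {r : ℕ}
    (hT : (T.map (TensorAlgebra.ι ℂ) :
      CStarMatrix (Fin m) (Fin m) (TensorAlgebra ℂ V)) ^ r = 0) :
    functionalImages T ^ r = ⊥ := by
  set U : CStarMatrix (Fin m) (Fin m) (TensorAlgebra ℂ V) := T.map (TensorAlgebra.ι ℂ) with hU
  let up : Matrix (Fin m) (Fin m) ℂ → CStarMatrix (Fin m) (Fin m) (TensorAlgebra ℂ V) :=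
    fun S => ofMatrix (S.map (algebraMap ℂ (TensorAlgebra ℂ V)))
  have hc : ∀ (ψ : V →ₗ[ℂ] ℂ) (u : TensorAlgebra ℂ V) (b : V) (s : ℂ),
      TensorAlgebra.contractLast ψ (u * (TensorAlgebra.ι ℂ b * algebraMap ℂ _ s)) =
        u * (algebraMap ℂ _ (ψ b) * algebraMap ℂ _ s) := by
    intro ψ u b s
    rw [← Algebra.commutes, ← Algebra.smul_def, mul_smul_comm, map_smul,
      TensorAlgebra.contractLast_mul_ι, ← map_mul, ← Algebra.commutes, ← Algebra.smul_def,
      smul_smul, mul_comm]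
  have key : ∀ k j, k + j = r → ∀ S ∈ functionalImages T ^ k, U ^ j * up S = 0 := by
    intro k
    induction k with
    | zero =>
      intro j hj S _
      obtain rfl : j = r := by omega
      rw [hT, zero_mul]
    | succ k ih =>
      intro j hj S hS
      rw [pow_succ'] at hS
      induction hS using Submodule.mul_induction_on' with
      | add a _ b _ ha hb =>
        have : up (a + b) = up a + up b := by
          ext i j; simp [up]
        rw [this, mul_add, ha, hb, add_zero]
      | mem_mul_mem a ha S hS =>
        obtain ⟨ψ, rfl⟩ := ha
        have h := ih (j + 1) (by omega) S hS
        ext i l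
        have h' := congrArg (fun M => TensorAlgebra.contractLast ψ (M i l)) h
        simp only [CStarMatrix.zero_apply, map_zero] at h' ⊢
        rw [← h', pow_succ, mul_assoc]
        simp only [mul_apply, Finset.mul_sum, map_sum, up, ofMatrix_apply, Matrix.map_apply,
          Matrix.mul_apply, map_mul]
        refine Finset.sum_congr rfl fun a _ => Finset.sum_congr rfl fun b _ => ?_
        exact (hc ψ _ _ _).symm
  rw [eq_bot_iff]
  intro S hS
  have h := key r 0 (by omega) S hS
  rw [pow_zero, one_mul] at h
  rw [Submodule.mem_bot]
  ext i j
  have h' : algebraMap ℂ (TensorAlgebra ℂ V) (S i j) = 0 := congrArg (fun M => M i j) h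
  simpa using h'

/-- If all linear functionals map `Z` into `W`, then they map `Z · g(T)` into
`W · functionalImages T`. -/
theorem mul_map_mem_functionalImages {R : Type*} [Ring R] [Algebra ℂ R] (g : V →ₗ[ℂ] R)
    (Z : CStarMatrix (Fin m) (Fin m) R) (W : Submodule ℂ (Matrix (Fin m) (Fin m) ℂ))
    (hZ : ∀ Λ : R →ₗ[ℂ] ℂ, (Matrix.of fun i j => Λ (Z i j)) ∈ W) (Λ : R →ₗ[ℂ] ℂ) :
    (Matrix.of fun i j => Λ ((Z * T.map g) i j)) ∈ W * functionalImages T := by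
  classical
  -- Expanding the finitely many entries of `T` in a basis turns the functional of a product into a
  -- finite sum of products of scalar matrices.
  let e := Module.Basis.ofVectorSpace ℂ V
  let s := Finset.univ.biUnion fun i => Finset.univ.biUnion fun j => (e.repr (T i j)).support
  have hT : ∀ i j, T i j = ∑ a ∈ s, e.coord a (T i j) • e a := by
    intro i j
    conv_lhs => rw [← e.linearCombination_repr (T i j), Finsupp.linearCombination_apply]
    refine Finset.sum_subset (fun a ha => ?_) fun a _ ha => ?_
    · simp only [s, Finset.mem_biUnion, Finset.mem_univ, true_and]
      exact ⟨i, j, ha⟩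
    · rw [Finsupp.notMem_support_iff.1 ha]
      exact zero_smul _ _
  have hsum : (Matrix.of fun i j => Λ ((Z * T.map g) i j)) =
      ∑ a ∈ s, (Matrix.of fun i j => (Λ ∘ₗ LinearMap.mulRight ℂ (g (e a))) (Z i j)) *
        (Matrix.of fun i j => e.coord a (T i j)) := by
    ext i k
    rw [Matrix.sum_apply]
    simp only [Matrix.of_apply, mul_apply, Matrix.mul_apply, map_apply, map_sum]
    rw [Finset.sum_comm]
    refine Finset.sum_congr rfl fun j _ => ?_
    conv_lhs => rw [hT j k]
    simp only [map_sum, map_smul, Finset.mul_sum, mul_smul_comm, LinearMap.comp_apply,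
      LinearMap.mulRight_apply, smul_eq_mul]
    exact Finset.sum_congr rfl fun a _ => mul_comm _ _
  rw [hsum]
  exact Submodule.sum_mem _ fun a _ =>
    Submodule.mul_mem_mul (hZ _) (of_mem_functionalImages T _)

/-- Converse criterion: functionals map the `k`-th power of `T` into `functionalImages T ^ k`, and
they separate the points of the tensor algebra. The larger space `J` allows the test to be made on
the transform of another matrix. -/
theorem map_ι_pow_eq_zero {J : Submodule ℂ (Matrix (Fin m) (Fin m) ℂ)}
    (hJ : functionalImages T ≤ J) {r : ℕ} (hr : J ^ r = ⊥) :
    (T.map (TensorAlgebra.ι ℂ) : CStarMatrix (Fin m) (Fin m) (TensorAlgebra ℂ V)) ^ r = 0 := by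
  have key : ∀ k, ∀ Λ : TensorAlgebra ℂ V →ₗ[ℂ] ℂ, (Matrix.of fun i j => Λ ((((T.map
      (TensorAlgebra.ι ℂ) : CStarMatrix (Fin m) (Fin m) (TensorAlgebra ℂ V)) ^ k)) i j)) ∈
      functionalImages T ^ k := by
    intro k
    induction k with
    | zero =>
      intro Λ
      rw [pow_zero, pow_zero]
      have : (Matrix.of fun i j => Λ ((1 : CStarMatrix (Fin m) (Fin m) (TensorAlgebra ℂ V)) i j)) =
          Λ 1 • (1 : Matrix (Fin m) (Fin m) ℂ) := by
        ext i j
        simp only [Matrix.of_apply, one_apply, Matrix.smul_apply, Matrix.one_apply]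
        split_ifs <;> simp
      rw [this]
      exact Submodule.smul_mem _ _ (Submodule.one_le.1 le_rfl)
    | succ k ih =>
      intro Λ
      rw [pow_succ, pow_succ]
      exact mul_map_mem_functionalImages T (TensorAlgebra.ι ℂ) _ _ ih Λ
  ext i j
  rw [CStarMatrix.zero_apply]
  refine (Module.forall_dual_apply_eq_zero_iff ℂ _).1 fun Λ => ?_
  have h := pow_le_pow_left' hJ r (key r Λ)
  rw [hr, Submodule.mem_bot] at h
  exact congrFun (congrFun h i) j

end

/-- A product of `r` elements of `J + J² + ⋯` lies in the sum of the powers `Jᵏ` with `k ≥ r`. -/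
theorem Submodule.iSup_pow_succ_pow_eq_bot {R : Type*} [Ring R] [Algebra ℂ R]
    {J : Submodule ℂ R} {r : ℕ} (hJ : J ^ r = ⊥) : (⨆ k, J ^ (k + 1)) ^ r = ⊥ := by
  have key : ∀ s, (⨆ k, J ^ (k + 1)) ^ s ≤ ⨆ k, J ^ (k + s) := by
    intro s
    induction s with
    | zero =>
      rw [pow_zero]
      exact le_iSup_of_le 0 le_rfl
    | succ s ih =>
      rw [pow_succ]
      refine (mul_le_mul' ih le_rfl).trans ?_
      rw [Submodule.iSup_mul]
      refine iSup_le fun k => ?_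
      rw [Submodule.mul_iSup]
      refine iSup_le fun l => ?_
      rw [← pow_add]
      exact le_iSup_of_le (k + l) (by rw [show k + s + (l + 1) = k + l + (s + 1) by ring])
  refine eq_bot_iff.2 ((key r).trans (iSup_le fun k => ?_))
  rw [pow_add, hJ, Submodule.mul_bot]

section

variable {B : Type*} [CStarAlgebra B] {m : ℕ}

/-- The homomorphism from the tensor algebra with `b ↦ 𝒳 b` carries `T` to `𝒳 · T`; hence the moment
series of a nilpotent matrix is a finite sum. -/
theorem xMul_pow_eq_zero {T : CStarMatrix (Fin m) (Fin m) B} {r : ℕ}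
    (hT : (T.map (TensorAlgebra.ι ℂ) :
      CStarMatrix (Fin m) (Fin m) (TensorAlgebra ℂ B)) ^ r = 0) : xMul T ^ r = 0 := by
  let g : TensorAlgebra ℂ B →ₐ[ℂ] NCPoly B := TensorAlgebra.lift ℂ
    (LinearMap.mulLeft ℂ (NCPoly.X B) ∘ₗ (NCPoly.C B).toLinearMap)
  have h : xMul T = mapHom (g : TensorAlgebra ℂ B →+* NCPoly B) (T.map (TensorAlgebra.ι ℂ)) := by
    ext i j
    change NCPoly.X B * NCPoly.C B (T i j) = g (TensorAlgebra.ι ℂ (T i j))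
    rw [TensorAlgebra.lift_ι_apply]
    rfl
  rw [h, ← map_pow, hT, map_zero]

theorem matMoment_eq_zero (μ : NCPoly B →ₗ[ℂ] B) {T : CStarMatrix (Fin m) (Fin m) B} {r : ℕ}
    (hT : (T.map (TensorAlgebra.ι ℂ) :
      CStarMatrix (Fin m) (Fin m) (TensorAlgebra ℂ B)) ^ r = 0) {k : ℕ} (hk : r ≤ k) :
    matMoment μ T k = 0 := by
  rw [matMoment, pow_eq_zero_of_le hk (xMul_pow_eq_zero hT)]
  ext i j
  simp

theorem mul_matMoment {μ : NCPoly B →ₗ[ℂ] B}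
    (hμ : ∀ b p b', μ (NCPoly.C B b * p * NCPoly.C B b') = b * μ p * b')
    (T : CStarMatrix (Fin m) (Fin m) B) (k : ℕ) :
    T * matMoment μ T k = (T.map (NCPoly.C B) * xMul T ^ k).map μ := by
  ext i j
  simp only [mul_apply, matMoment, map_apply, map_sum]
  refine Finset.sum_congr rfl fun l _ => ?_
  simpa using (hμ (T i l) ((xMul T ^ k) l j) 1).symm

variable [PartialOrder B] [StarOrderedRing B]

theorem hTransform_eq_sum (μ : NCPoly B →ₗ[ℂ] B) {T : CStarMatrix (Fin m) (Fin m) B} {r : ℕ}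
    (hT : (T.map (TensorAlgebra.ι ℂ) :
      CStarMatrix (Fin m) (Fin m) (TensorAlgebra ℂ B)) ^ r = 0) :
    hTransform μ T = ∑ k ∈ Finset.range r, T * matMoment μ T k := by
  rw [hTransform, momentSeries, tsum_eq_sum (s := Finset.range r), Finset.mul_sum]
  intro k hk
  exact matMoment_eq_zero μ hT (by simpa using hk)

/-- The transform preserves the order of nilpotency. -/
theorem hTransform_map_ι_pow_eq_zero {μ : NCPoly B →ₗ[ℂ] B}
    (hμ : ∀ b p b', μ (NCPoly.C B b * p * NCPoly.C B b') = b * μ p * b')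
    {T : CStarMatrix (Fin m) (Fin m) B} {r : ℕ}
    (hT : (T.map (TensorAlgebra.ι ℂ) :
      CStarMatrix (Fin m) (Fin m) (TensorAlgebra ℂ B)) ^ r = 0) :
    ((hTransform μ T).map (TensorAlgebra.ι ℂ) :
      CStarMatrix (Fin m) (Fin m) (TensorAlgebra ℂ B)) ^ r = 0 := by
  -- Here `J` is the sum of all positive powers of `functionalImages T`: the `k`-th term of the
  -- transform has its functional images in the power `k + 1`.
  refine map_ι_pow_eq_zero _ ?_
    (Submodule.iSup_pow_succ_pow_eq_bot (functionalImages_pow_eq_bot T hT))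
  have key : ∀ k, ∀ Λ : NCPoly B →ₗ[ℂ] ℂ, (Matrix.of fun i j =>
      Λ ((T.map (NCPoly.C B) * xMul T ^ k) i j)) ∈ functionalImages T ^ (k + 1) := by
    intro k
    induction k with
    | zero =>
      intro Λ
      rw [zero_add, pow_one, pow_zero, mul_one]
      exact of_mem_functionalImages T (Λ ∘ₗ (NCPoly.C B).toLinearMap)
    | succ k ih =>
      intro Λ
      rw [pow_succ (xMul T), ← mul_assoc, pow_succ (functionalImages T)]
      exact mul_map_mem_functionalImages T
        (LinearMap.mulLeft ℂ (NCPoly.X B) ∘ₗ (NCPoly.C B).toLinearMap) _ _ ih Λ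
  rintro _ ⟨ψ, rfl⟩
  have hsum : (Matrix.of fun i j => ψ (hTransform μ T i j)) = ∑ k ∈ Finset.range r,
      Matrix.of fun i j => (ψ ∘ₗ μ) ((T.map (NCPoly.C B) * xMul T ^ k) i j) := by
    rw [hTransform_eq_sum μ hT]
    ext i j
    rw [Matrix.sum_apply]
    have : (∑ k ∈ Finset.range r, T * matMoment μ T k) i j =
        ∑ k ∈ Finset.range r, (T * matMoment μ T k) i j :=
      Matrix.sum_apply i j (Finset.range r) fun k => (T * matMoment μ T k : Matrix _ _ B)
    rw [Matrix.of_apply, this, map_sum]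
    refine Finset.sum_congr rfl fun k _ => ?_
    rw [mul_matMoment hμ]
    rfl
  exact hsum ▸ Submodule.sum_mem _ fun k _ =>
    Submodule.mem_iSup_of_mem k (key k _)

end

end

/-! ### Moment series of a functional and convergence of its transform -/

noncomputable section

open CStarMatrix FormalMultilinearSeries

section

variable {B : Type*} [CStarAlgebra B]

/-- `B⟨𝒳⟩` is spanned by the words `b₀ 𝒳 b₁ 𝒳 ⋯ 𝒳 bₙ`. -/
theorem NCPoly.mem_span_words (f : NCPoly B) : f ∈ Submodule.span ℂ
    {p : NCPoly B | ∃ (b : B) (l : List B), p = C B b * (l.map fun c => X B * C B c).prod} := by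
  set W := {p : NCPoly B | ∃ (b : B) (l : List B), p = C B b * (l.map fun c => X B * C B c).prod}
  have h1 : (1 : NCPoly B) ∈ Submodule.span ℂ W :=
    Submodule.subset_span ⟨1, [], by simp⟩
  have of_word : ∀ f : NCPoly B, (∀ g ∈ W, f * g ∈ Submodule.span ℂ W) →
      ∀ g ∈ Submodule.span ℂ W, f * g ∈ Submodule.span ℂ W := fun f h g hg =>
    (Submodule.span_le (p := (Submodule.span ℂ W).comap (LinearMap.mulLeft ℂ f))).2 h hg
  have key : ∀ f : NCPoly B, ∀ g ∈ Submodule.span ℂ W, f * g ∈ Submodule.span ℂ W := by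
    intro f
    induction f using NCPoly.induction with
    | hC b =>
      refine of_word _ ?_
      rintro _ ⟨b', l, rfl⟩
      exact Submodule.subset_span ⟨b * b', l, by rw [map_mul, mul_assoc]⟩
    | hX =>
      refine of_word _ ?_
      rintro _ ⟨b', l, rfl⟩
      exact Submodule.subset_span ⟨1, b' :: l, by simp [mul_assoc]⟩
    | hadd p q hp hq =>
      intro g hg
      rw [add_mul]
      exact Submodule.add_mem _ (hp g hg) (hq g hg)
    | hmul p q hp hq =>
      intro g hg
      rw [mul_assoc]
      exact hp _ (hq g hg)
  simpa using key f 1 h1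

theorem polyWord_scalarMat_apply (b : B) (l : List B) :
    polyWord ((b :: l).map (scalarMat 1)) 0 0 =
      NCPoly.C B b * (l.map fun c => NCPoly.X B * NCPoly.C B c).prod := by
  let φ : CStarMatrix (Fin 1) (Fin 1) (NCPoly B) →+* NCPoly B :=
    { toFun := fun M => M 0 0
      map_one' := by simp [one_apply]
      map_mul' := fun M N => by simp [mul_apply]
      map_zero' := rfl
      map_add' := fun _ _ => rfl }
  change φ _ = _
  have h : φ ((scalarMat 1 b).map (NCPoly.C B) * ((l.map (scalarMat 1)).map xMul).prod) =
      NCPoly.C B b * (l.map fun c => NCPoly.X B * NCPoly.C B c).prod := by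
    rw [map_mul, map_list_prod, List.map_map, List.map_map]
    rfl
  exact h

/-- Entries of the matrix words of nonempty lists span `B⟨𝒳⟩`. -/
theorem NCPoly.induction_polyWord {S : Submodule ℂ (NCPoly B)}
    (h : ∀ (n : ℕ) (v : Fin (n + 1) → CStarMatrix (Fin 1) (Fin 1) B),
      polyWord (List.ofFn v) 0 0 ∈ S) (f : NCPoly B) : f ∈ S := by
  refine Submodule.span_le.2 ?_ (NCPoly.mem_span_words f)
  rintro _ ⟨b, l, rfl⟩
  have := h l.length (fun i => ((b :: l).map (scalarMat 1)).get (i.cast (by simp)))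
  have e : (List.ofFn fun i : Fin (l.length + 1) =>
      ((b :: l).map (scalarMat 1)).get (i.cast (by simp))) = (b :: l).map (scalarMat 1) := by
    rw [List.ext_get_iff]
    simp
  rw [e, polyWord_scalarMat_apply] at this
  exact this

/-- Only an inequality, since the norm is zero for `m = 0`. -/
theorem CStarMatrix.norm_one_le [PartialOrder B] [StarOrderedRing B] (m : ℕ) :
    ‖(1 : CStarMatrix (Fin m) (Fin m) B)‖ ≤ 1 := by
  have h := CStarRing.norm_star_mul_self (x := (1 : CStarMatrix (Fin m) (Fin m) B))
  rw [star_one, mul_one] at h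
  by_contra! h1
  nlinarith

theorem polyWord_map_dilation {m : ℕ} (c : ℝ) (μ : NCPoly B →ₗ[ℂ] B)
    (b : CStarMatrix (Fin m) (Fin m) B) (l : List (CStarMatrix (Fin m) (Fin m) B)) :
    (polyWord (b :: l)).map (dilation c μ) =
      (c : ℂ) ^ l.length • (polyWord (b :: l)).map μ := by
  let δ := NCPoly.lift (NCPoly.C B) ((c : ℂ) • NCPoly.X B)
  have hx : ∀ b : CStarMatrix (Fin m) (Fin m) B,
      mapHom (δ : NCPoly B →+* NCPoly B) (xMul b) = (c : ℂ) • xMul b := by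
    intro b
    ext i j
    change δ (NCPoly.X B * NCPoly.C B (b i j)) = (c : ℂ) • (NCPoly.X B * NCPoly.C B (b i j))
    rw [map_mul, NCPoly.lift_X, NCPoly.lift_C, smul_mul_assoc]
  have hb : mapHom (δ : NCPoly B →+* NCPoly B) (b.map (NCPoly.C B)) = b.map (NCPoly.C B) := by
    ext i j
    exact NCPoly.lift_C _ _ _
  have hprod : mapHom (δ : NCPoly B →+* NCPoly B) (l.map xMul).prod =
      (c : ℂ) ^ l.length • (l.map xMul).prod := by
    induction l with
    | nil => simp
    | cons a l ih =>
      rw [List.map_cons, List.prod_cons, map_mul, ih, hx, smul_mul_smul_comm, List.length_cons,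
        pow_succ']
  have h : mapHom (δ : NCPoly B →+* NCPoly B) (polyWord (b :: l)) =
      (c : ℂ) ^ l.length • polyWord (b :: l) := by
    rw [polyWord, map_mul, hb, hprod, mul_smul_comm]
  ext i j
  have h' := congrArg (fun M => μ (M i j)) h
  exact h'.trans (map_smul μ _ _)

theorem matMoment_eq_polyWord_map {m : ℕ} (μ : NCPoly B →ₗ[ℂ] B)
    (b : CStarMatrix (Fin m) (Fin m) B) (k : ℕ) :
    matMoment μ b k = (polyWord (1 :: List.replicate k b)).map μ := by
  have h1 : (1 : CStarMatrix (Fin m) (Fin m) B).map (NCPoly.C B) = 1 :=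
    map_one (mapHom (NCPoly.C B : B →+* NCPoly B))
  rw [polyWord, h1, one_mul, List.map_replicate, List.prod_replicate, matMoment]

end

/-- `p` is the moment series of `μ` on `m × m` matrices: its `(n + 1)`-st term is
`(b₀, …, bₙ) ↦ μ̃(b₀ 𝒳 b₁ 𝒳 ⋯ 𝒳 bₙ)`. -/
structure IsMomentSeries {B : Type*} [CStarAlgebra B] [PartialOrder B] [StarOrderedRing B]
    {m : ℕ} (μ : NCPoly B →ₗ[ℂ] B)
    (p : FormalMultilinearSeries ℂ (CStarMatrix (Fin m) (Fin m) B)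
      (CStarMatrix (Fin m) (Fin m) B)) : Prop where
  zero : p 0 = 0
  succ : ∀ n (v : Fin (n + 1) → CStarMatrix (Fin m) (Fin m) B),
    p (n + 1) v = (polyWord (List.ofFn v)).map μ

namespace IsMomentSeries

variable {B : Type*} [CStarAlgebra B] [PartialOrder B] [StarOrderedRing B]
    {m : ℕ} {μ : NCPoly B →ₗ[ℂ] B}
    {p q : FormalMultilinearSeries ℂ (CStarMatrix (Fin m) (Fin m) B)
      (CStarMatrix (Fin m) (Fin m) B)}

theorem unique (hp : IsMomentSeries μ p) (hq : IsMomentSeries μ q) : p = q := by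
  ext n v : 2
  cases n with
  | zero => rw [hp.zero, hq.zero]
  | succ n => rw [hp.succ, hq.succ]

/-- Words in `1 × 1` matrices already span all polynomials. -/
theorem eq_law {μ ν : NCPoly B →ₗ[ℂ] B}
    {p : FormalMultilinearSeries ℂ (CStarMatrix (Fin 1) (Fin 1) B)
      (CStarMatrix (Fin 1) (Fin 1) B)} (hp : IsMomentSeries μ p) (hq : IsMomentSeries ν p) :
    μ = ν := by
  ext f
  refine NCPoly.induction_polyWord (S := LinearMap.eqLocus μ ν) (fun n v => ?_) f
  exact congrArg (fun M => M 0 0) ((hp.succ n v).symm.trans (hq.succ n v))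

theorem dilation (hp : IsMomentSeries μ p) (c : ℝ) :
    IsMomentSeries (dilation c μ) (p.dil (c : ℂ)) where
  zero := by simp [dil, hp.zero]
  succ n v := by
    rw [List.ofFn_succ, polyWord_map_dilation, ← List.ofFn_succ, dil, _root_.smul_apply, hp.succ,
      List.length_ofFn, Nat.add_sub_cancel]

theorem norm_polyWord_map_le (hp : IsMomentSeries μ p) {M : ℝ}
    (hM : ∀ n, ‖p n‖ ≤ M ^ (n - 1)) (b : CStarMatrix (Fin m) (Fin m) B)
    (l : List (CStarMatrix (Fin m) (Fin m) B)) :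
    ‖(polyWord (b :: l)).map μ‖ ≤ M ^ l.length * (‖b‖ * (l.map norm).prod) := by
  have h := hp.succ l.length (b :: l).get
  rw [show List.ofFn (b :: l).get = b :: l from List.ofFn_get _] at h
  rw [← h]
  refine ((p (l.length + 1)).le_opNorm _).trans ?_
  have hprod : ∏ i, ‖(b :: l).get i‖ = ‖b‖ * (l.map norm).prod := by
    rw [← List.prod_cons, ← List.map_cons (f := norm), ← List.prod_ofFn]
    conv_rhs => rw [← List.ofFn_get (b :: l), List.map_ofFn]
    rfl
  rw [← hprod]
  exact mul_le_mul_of_nonneg_right (hM _) (by positivity)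

theorem norm_matMoment_le (hp : IsMomentSeries μ p) {M : ℝ} (hM0 : 0 ≤ M)
    (hM : ∀ n, ‖p n‖ ≤ M ^ (n - 1)) (b : CStarMatrix (Fin m) (Fin m) B) (k : ℕ) :
    ‖matMoment μ b k‖ ≤ (M * ‖b‖) ^ k := by
  rw [matMoment_eq_polyWord_map]
  refine (hp.norm_polyWord_map_le hM _ _).trans ?_
  rw [List.length_replicate, List.map_replicate, List.prod_replicate, mul_pow]
  gcongr
  exact mul_le_of_le_one_left (by positivity) (norm_one_le m)

theorem summable_matMoment (hp : IsMomentSeries μ p) {M : ℝ} (hM0 : 0 ≤ M)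
    (hM : ∀ n, ‖p n‖ ≤ M ^ (n - 1)) {b : CStarMatrix (Fin m) (Fin m) B} (hb : M * ‖b‖ < 1) :
    Summable (matMoment μ b) :=
  Summable.of_norm_bounded (summable_geometric_of_lt_one (by positivity) hb)
    (hp.norm_matMoment_le hM0 hM b)

theorem norm_hTransform_le (hp : IsMomentSeries μ p) {M : ℝ} (hM0 : 0 ≤ M)
    (hM : ∀ n, ‖p n‖ ≤ M ^ (n - 1)) {b : CStarMatrix (Fin m) (Fin m) B} (hb : M * ‖b‖ < 1) :
    ‖hTransform μ b‖ ≤ ‖b‖ * (1 - M * ‖b‖)⁻¹ := by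
  refine (norm_mul_le _ _).trans ?_
  gcongr
  exact tsum_of_norm_bounded (hasSum_geometric_of_lt_one (by positivity) hb)
    (hp.norm_matMoment_le hM0 hM b)

theorem apply_const (hp : IsMomentSeries μ p)
    (hμ : ∀ b p b', μ (NCPoly.C B b * p * NCPoly.C B b') = b * μ p * b')
    (b : CStarMatrix (Fin m) (Fin m) B) (k : ℕ) :
    p (k + 1) (fun _ => b) = b * matMoment μ b k := by
  rw [hp.succ, mul_matMoment hμ, List.ofFn_const, List.replicate_succ, polyWord,
    List.map_replicate, List.prod_replicate]

/-- On the diagonal the series is `b · μ̃([𝒳 b]ᵏ)`, and the growth bound gives the radius `1/M`.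
This makes the composition and identity theorems for analytic functions available. -/
theorem hasFPowerSeriesOnBall (hp : IsMomentSeries μ p)
    (hμ : ∀ b p b', μ (NCPoly.C B b * p * NCPoly.C B b') = b * μ p * b')
    {M : ℝ} (hM0 : 0 < M) (hM : ∀ n, ‖p n‖ ≤ M ^ (n - 1)) :
    HasFPowerSeriesOnBall (hTransform μ) p 0 (ENNReal.ofReal M⁻¹) where
  r_le := by
    refine p.le_radius_of_bound M⁻¹ fun n => ?_
    rw [Real.coe_toNNReal _ (by positivity)]
    cases n with
    | zero => simp [hp.zero, hM0.le]
    | succ n =>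
      calc _ ≤ M ^ n * M⁻¹ ^ (n + 1) := by gcongr; exact hM (n + 1)
        _ = M⁻¹ := by rw [pow_succ, ← mul_assoc, ← mul_pow, mul_inv_cancel₀ hM0.ne']; simp
  r_pos := by simpa using hM0
  hasSum {b} hb := by
    rw [Metric.mem_eball, edist_dist, ENNReal.ofReal_lt_ofReal_iff (by positivity),
      dist_zero_right] at hb
    have hb' : M * ‖b‖ < 1 := by
      rw [← mul_inv_cancel₀ hM0.ne']
      gcongr
    rw [zero_add, ← hasSum_nat_add_iff' 1]
    simp only [Finset.range_one, Finset.sum_singleton, hp.zero, hp.apply_const hμ,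
      _root_.zero_apply, sub_zero]
    exact (hp.summable_matMoment hM0.le hM hb').hasSum.mul_left b

/-- A polynomial map that agrees with the transform on nilpotent matrices. -/
theorem hTransform_eq_sum (hp : IsMomentSeries μ p)
    (hμ : ∀ b p b', μ (NCPoly.C B b * p * NCPoly.C B b') = b * μ p * b')
    {T : CStarMatrix (Fin m) (Fin m) B} {r : ℕ}
    (hT : (T.map (TensorAlgebra.ι ℂ) :
      CStarMatrix (Fin m) (Fin m) (TensorAlgebra ℂ B)) ^ r = 0) :
    hTransform μ T = ∑ k ∈ Finset.range r, p (k + 1) (fun _ => T) := by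
  rw [_root_.hTransform_eq_sum μ hT]
  exact Finset.sum_congr rfl fun k _ => (hp.apply_const hμ T k).symm

end IsMomentSeries

end

/-! ### The composition identity for the transforms -/

noncomputable section

open CStarMatrix FormalMultilinearSeries

theorem summable_matMoment_of_nilpotent {B : Type*} [CStarAlgebra B] {m : ℕ} (μ : NCPoly B →ₗ[ℂ] B)
    {T : CStarMatrix (Fin m) (Fin m) B} {r : ℕ}
    (hT : (T.map (TensorAlgebra.ι ℂ) :
      CStarMatrix (Fin m) (Fin m) (TensorAlgebra ℂ B)) ^ r = 0) : Summable (matMoment μ T) :=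
  summable_of_ne_finset_zero (s := Finset.range r) fun k hk =>
    matMoment_eq_zero μ hT (by simpa using hk)

section

variable {B : Type*} [CStarAlgebra B] [PartialOrder B] [StarOrderedRing B]

theorem IsBDistribution.dilation_bimodule {μ : NCPoly B →ₗ[ℂ] B} (hμ : IsBDistribution μ) (c : ℝ)
    (b : B) (p : NCPoly B) (b' : B) :
    dilation c μ (NCPoly.C B b * p * NCPoly.C B b') = b * dilation c μ p * b' := by
  let δ := NCPoly.lift (NCPoly.C B) ((c : ℂ) • NCPoly.X B)
  change μ (δ _) = b * μ (δ _) * b'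
  rw [map_mul δ, map_mul δ, NCPoly.lift_C, NCPoly.lift_C, hμ.bimodule]

variable {m : ℕ} {μ : NCPoly B →ₗ[ℂ] B}
    {p : FormalMultilinearSeries ℂ (CStarMatrix (Fin m) (Fin m) B)
      (CStarMatrix (Fin m) (Fin m) B)}

namespace IsMomentSeries

theorem norm_dil_le {M : ℝ} (hM : ∀ n, ‖p n‖ ≤ M ^ (n - 1)) (n : ℕ) :
    ‖p.dil (Real.sqrt 2 : ℂ) n‖ ≤ (Real.sqrt 2 * M) ^ (n - 1) := by
  rw [dil, norm_smul, norm_pow, Complex.norm_real, Real.norm_of_nonneg (Real.sqrt_nonneg 2),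
    mul_pow]
  exact mul_le_mul_of_nonneg_left (hM n) (by positivity)

/-- Origin of the radius `1/(2M)`: if `M‖b‖ < 1/2`, then `‖b‖ / (1 - M‖b‖) < 1/M`, so the second
transform converges as well. -/
theorem norm_hTransform_lt (hp : IsMomentSeries μ p) {M : ℝ} (hM0 : 0 < M)
    (hM : ∀ n, ‖p n‖ ≤ M ^ (n - 1)) {b : CStarMatrix (Fin m) (Fin m) B} (hb : ‖b‖ < (2 * M)⁻¹) :
    ‖hTransform μ b‖ < M⁻¹ := by
  have h2 : 2 * (M * ‖b‖) < 1 := by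
    rw [← mul_assoc]
    calc _ < 2 * M * (2 * M)⁻¹ := by gcongr
      _ = 1 := mul_inv_cancel₀ (by positivity)
  have h0 := mul_nonneg hM0.le (norm_nonneg b)
  refine (hp.norm_hTransform_le hM0.le hM (by linarith)).trans_lt ?_
  rw [← div_eq_mul_inv, div_lt_iff₀ (by linarith)]
  calc ‖b‖ = M⁻¹ * (M * ‖b‖) := by rw [inv_mul_cancel_left₀ hM0.ne']
    _ < M⁻¹ * (1 - M * ‖b‖) := by gcongr; linarith

/-- The composition identity of the moment series gives the identity of the transforms on a ball
whose radius depends only on the growth of the moments. -/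
theorem hTransform_hTransform (hp : IsMomentSeries μ p) (hμ : IsBDistribution μ) {M : ℝ}
    (hM0 : 0 < M) (hM : ∀ n, ‖p n‖ ≤ M ^ (n - 1))
    (hcomp : p.comp p = p.dil (Real.sqrt 2 : ℂ))
    {b : CStarMatrix (Fin m) (Fin m) B} (hb : ‖b‖ < (2 * M)⁻¹) :
    Summable (matMoment μ b) ∧ Summable (matMoment μ (hTransform μ b)) ∧
      Summable (matMoment (_root_.dilation (Real.sqrt 2) μ) b) ∧
      hTransform μ (hTransform μ b) = hTransform (_root_.dilation (Real.sqrt 2) μ) b := by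
  have hs0 : 0 < Real.sqrt 2 := by positivity
  have hs2 : Real.sqrt 2 < 2 := by
    rw [Real.sqrt_lt' two_pos]; norm_num
  have hlt : ∀ {K : ℝ} {c : CStarMatrix (Fin m) (Fin m) B}, 0 < K → ‖c‖ < K⁻¹ → K * ‖c‖ < 1 := by
    intro K c hK hc
    calc _ < K * K⁻¹ := by gcongr
      _ = 1 := mul_inv_cancel₀ hK.ne'
  have hle1 : (2 * M)⁻¹ ≤ M⁻¹ := by gcongr; linarith
  have hle2 : (2 * M)⁻¹ ≤ (Real.sqrt 2 * M)⁻¹ := by gcongr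
  have hK0 : 0 < Real.sqrt 2 * M := by positivity
  have hq := hp.dilation (Real.sqrt 2)
  have hf := hp.hasFPowerSeriesOnBall hμ.bimodule hM0 hM
  have hg := hq.hasFPowerSeriesOnBall (hμ.dilation_bimodule _) hK0 (norm_dil_le hM)
  refine ⟨hp.summable_matMoment hM0.le hM (hlt hM0 (hb.trans_le hle1)),
    hp.summable_matMoment hM0.le hM (hlt hM0 (hp.norm_hTransform_lt hM0 hM hb)),
    hq.summable_matMoment hK0.le (norm_dil_le hM) (hlt hK0 (hb.trans_le hle2)), ?_⟩
  have h0 : hTransform μ (0 : CStarMatrix (Fin m) (Fin m) B) = 0 := by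
    rw [hTransform, zero_mul]
  have hf' : HasFPowerSeriesAt (hTransform μ) p (hTransform μ 0) := by
    rw [h0]; exact hf.hasFPowerSeriesAt
  -- Equal power series give equality only near zero, on a ball that could depend on `m`. Both sides
  -- are analytic on the ball of radius `1/(2M)`, which is convex, so equality extends to all of it.
  have hev : (hTransform μ ∘ hTransform μ) =ᶠ[𝓝 (0 : CStarMatrix (Fin m) (Fin m) B)]
      hTransform (_root_.dilation (Real.sqrt 2) μ) := by
    have h1 := hf'.comp hf.hasFPowerSeriesAt
    rw [hcomp] at h1
    obtain ⟨r, hr⟩ := h1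
    filter_upwards [Metric.eball_mem_nhds (0 : CStarMatrix (Fin m) (Fin m) B)
      (lt_min hr.r_pos hg.r_pos)] with c hc
    rw [Metric.mem_eball, lt_min_iff] at hc
    have e1 := hr.hasSum (y := c) hc.1
    have e2 := hg.hasSum (y := c) hc.2
    rw [zero_add] at e1 e2
    exact e1.unique e2
  have hball : ∀ K : ℝ, Metric.eball (0 : CStarMatrix (Fin m) (Fin m) B) (ENNReal.ofReal K) =
      Metric.ball 0 K := fun K => Metric.eball_ofReal
  have hfa := hf.analyticOnNhd
  have hga := hg.analyticOnNhd
  rw [hball] at hfa hga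
  have hA : AnalyticOnNhd ℂ (hTransform μ ∘ hTransform μ)
      (Metric.ball (0 : CStarMatrix (Fin m) (Fin m) B) (2 * M)⁻¹) :=
    AnalyticOnNhd.comp hfa (hfa.mono (Metric.ball_subset_ball hle1)) fun c hc => by
      rw [mem_ball_zero_iff] at hc ⊢
      exact hp.norm_hTransform_lt hM0 hM hc
  exact hA.eqOn_of_preconnected_of_eventuallyEq (hga.mono (Metric.ball_subset_ball hle2))
    (convex_ball _ _).isPreconnected (Metric.mem_ball_self (by positivity)) hev
    (mem_ball_zero_iff.2 hb)

/-- On multiples of `T` the transforms agree with polynomial maps `f` and `g`; the same `r` serves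
for the inner and the outer transform. The entire functions `f(f(εT))` and `g(εT)` of `ε` agree for
small `ε` by the identity on the ball, hence at `ε = 1`. -/
theorem hTransform_hTransform_of_nilpotent (hp : IsMomentSeries μ p) (hμ : IsBDistribution μ)
    {M : ℝ} (hM0 : 0 < M) (hM : ∀ n, ‖p n‖ ≤ M ^ (n - 1))
    (hcomp : p.comp p = p.dil (Real.sqrt 2 : ℂ)) {T : CStarMatrix (Fin m) (Fin m) B} {r : ℕ}
    (hT : (T.map (TensorAlgebra.ι ℂ) :
      CStarMatrix (Fin m) (Fin m) (TensorAlgebra ℂ B)) ^ r = 0) :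
    hTransform μ (hTransform μ T) = hTransform (_root_.dilation (Real.sqrt 2) μ) T := by
  have hq := hp.dilation (Real.sqrt 2)
  let f : CStarMatrix (Fin m) (Fin m) B → CStarMatrix (Fin m) (Fin m) B := fun b =>
    ∑ k ∈ Finset.range r, p (k + 1) (fun _ => b)
  let g : CStarMatrix (Fin m) (Fin m) B → CStarMatrix (Fin m) (Fin m) B := fun b =>
    ∑ k ∈ Finset.range r, p.dil (Real.sqrt 2 : ℂ) (k + 1) (fun _ => b)
  have han : ∀ q : FormalMultilinearSeries ℂ (CStarMatrix (Fin m) (Fin m) B)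
      (CStarMatrix (Fin m) (Fin m) B), Differentiable ℂ
      fun b => ∑ k ∈ Finset.range r, q (k + 1) (fun _ => b) := fun q =>
    Differentiable.fun_sum fun k _ => fun b =>
      ((q (k + 1)).hasFDerivAt _).differentiableAt.comp b
        (differentiableAt_pi.2 fun _ => differentiableAt_id)
  have hdil : ∀ ε : ℂ, ((ε • T).map (TensorAlgebra.ι ℂ) :
      CStarMatrix (Fin m) (Fin m) (TensorAlgebra ℂ B)) ^ r = 0 := by
    intro ε
    have : ((ε • T).map (TensorAlgebra.ι ℂ) : CStarMatrix (Fin m) (Fin m) (TensorAlgebra ℂ B)) =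
        ε • T.map (TensorAlgebra.ι ℂ) := by
      ext i j
      exact map_smul (TensorAlgebra.ι ℂ) ε (T i j)
    rw [this, smul_pow, hT, smul_zero]
  have hcomp_eq : ∀ ε : ℂ, hTransform μ (hTransform μ (ε • T)) = f (f (ε • T)) := fun ε => by
    rw [hp.hTransform_eq_sum hμ.bimodule (hTransform_map_ι_pow_eq_zero hμ.bimodule (hdil ε)),
      hp.hTransform_eq_sum hμ.bimodule (hdil ε)]
  have hdil_eq : ∀ ε : ℂ, hTransform (_root_.dilation (Real.sqrt 2) μ) (ε • T) = g (ε • T) :=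
    fun ε => hq.hTransform_eq_sum (hμ.dilation_bimodule _) (hdil ε)
  have hline : Differentiable ℂ fun ε : ℂ => ε • T := differentiable_id.smul_const T
  have h1 : AnalyticOnNhd ℂ (fun ε : ℂ => f (f (ε • T))) Set.univ := fun z _ =>
    ((han p).comp ((han p).comp hline)).analyticAt z
  have h2 : AnalyticOnNhd ℂ (fun ε : ℂ => g (ε • T)) Set.univ := fun z _ =>
    ((han _).comp hline).analyticAt z
  have hev : (fun ε : ℂ => f (f (ε • T))) =ᶠ[𝓝 0] fun ε : ℂ => g (ε • T) := by
    have hc : Tendsto (fun ε : ℂ => ‖ε • T‖) (𝓝 0) (𝓝 0) := by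
      have := (hline.continuous.norm).tendsto 0
      simpa using this
    filter_upwards [hc.eventually_lt_const (show 0 < (2 * M)⁻¹ by positivity)] with ε hε
    rw [← hcomp_eq, ← hdil_eq]
    exact (hp.hTransform_hTransform hμ hM0 hM hcomp hε).2.2.2
  have h := (hcomp_eq 1).trans ((congrFun (h1.eq_of_eventuallyEq h2 hev) 1).trans (hdil_eq 1).symm)
  rwa [one_smul] at h

end IsMomentSeries

/-- A bound on the moment series that is uniform in the size of the matrices. -/
theorem exponentiallyBounded_of_isMomentSeries {M : ℝ} (hM0 : 0 < M)
    (h : ∀ m : ℕ, ∃ p : FormalMultilinearSeries ℂ (CStarMatrix (Fin m) (Fin m) B)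
      (CStarMatrix (Fin m) (Fin m) B), IsMomentSeries μ p ∧ ∀ n, ‖p n‖ ≤ M ^ (n - 1)) :
    ExponentiallyBounded μ := by
  refine ⟨M, hM0, fun m n b => ?_⟩
  obtain ⟨p, hp, hM⟩ := h m
  -- The outer coefficients are `1`: the word is `1 𝒳 b₁ 𝒳 ⋯ 𝒳 bₙ 𝒳 1`, with `n + 1` letters `𝒳`.
  have hb := hp.norm_polyWord_map_le hM 1 (List.ofFn b ++ [1])
  have h1 : (1 : CStarMatrix (Fin m) (Fin m) B).map (NCPoly.C B) = 1 :=
    map_one (mapHom (NCPoly.C B : B →+* NCPoly B))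
  have hX : xMul (1 : CStarMatrix (Fin m) (Fin m) B) = scalarMat m (NCPoly.X B) := by
    ext i j
    simp only [xMul, map_apply, one_apply, scalarMat, ofMatrix_apply, Matrix.diagonal_apply]
    split_ifs <;> simp
  have he : (polyWord (1 :: (List.ofFn b ++ [1]))).map μ =
      (List.ofFn fun i => xMul (b i)).prod.map (fun p => μ (p * NCPoly.X B)) := by
    rw [polyWord, h1, one_mul, List.map_append, List.prod_append, List.map_ofFn, List.map_singleton,
      List.prod_singleton, hX]
    ext i j
    rw [map_apply, map_apply, mul_scalarMat_apply]
    rfl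
  rw [he] at hb
  refine hb.trans ?_
  rw [List.length_append, List.length_ofFn, List.length_singleton, List.map_append,
    List.prod_append, List.map_ofFn, List.prod_ofFn, List.map_singleton, List.prod_singleton]
  have hone := norm_one_le (B := B) m
  have hP : 0 ≤ ∏ i, ‖b i‖ := by positivity
  gcongr
  change ‖(1 : CStarMatrix (Fin m) (Fin m) B)‖ *
    ((∏ i, ‖b i‖) * ‖(1 : CStarMatrix (Fin m) (Fin m) B)‖) ≤ _
  exact (mul_le_of_le_one_left (by positivity) hone).trans (mul_le_of_le_one_right hP hone)

end

/-! ### The central limit law and its convolution with itself -/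

namespace BProbSpace

variable {B A : Type*} [CStarAlgebra B] [PartialOrder B] [StarOrderedRing B] [CStarAlgebra A]
  {P : BProbSpace B A}

theorem eval_star {x : A} (hx : IsSelfAdjoint x) (f : NCPoly B) :
    P.eval x (star f) = star (P.eval x f) := by
  induction f using NCPoly.induction with
  | hC b => rw [NCPoly.star_C, eval_C, eval_C, map_star]
  | hX => rw [NCPoly.star_X, eval_X, hx.star_eq]
  | hadd p q hp hq => rw [star_add, map_add, map_add, star_add, hp, hq]
  | hmul p q hp hq => rw [star_mul, map_mul, map_mul, star_mul, hp, hq]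

theorem isBDistribution_law {x : A} (hx : IsSelfAdjoint x) : IsBDistribution (P.law x) where
  map_C b := by
    change P.E (P.eval x _) = b
    rw [eval_C, P.E_incl]
  bimodule b p b' := by
    change P.E (P.eval x _) = b * P.E (P.eval x p) * b'
    rw [map_mul (P.eval x), map_mul (P.eval x), eval_C, eval_C, P.E_bimodule]
  pos p := by
    change 0 ≤ P.E (P.eval x _)
    rw [map_mul, eval_star hx]
    exact P.E_pos _

theorem isSelfAdjoint_normalizedSum {x : ℕ → A} (hx : ∀ i, IsSelfAdjoint (x i)) (N : ℕ) :
    IsSelfAdjoint (normalizedSum x N) := by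
  refine IsSelfAdjoint.smul ?_ (isSelfAdjoint_sum _ fun i _ => hx i)
  rw [← Complex.ofReal_inv]
  exact Complex.conj_ofReal _

theorem IsArcsineLaw.isBDistribution {x : ℕ → A} {𝔞 : NCPoly B →ₗ[ℂ] B}
    (h : P.IsArcsineLaw x 𝔞) (hx : ∀ i, IsSelfAdjoint (x i)) : IsBDistribution 𝔞 := by
  have hN := fun N => isBDistribution_law (P := P) (isSelfAdjoint_normalizedSum hx N)
  refine ⟨fun b => ?_, fun b p b' => ?_, fun p => ?_⟩
  · refine tendsto_nhds_unique (h _) ?_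
    simp only [(hN _).map_C]
    exact tendsto_const_nhds
  · refine tendsto_nhds_unique (h _) ?_
    simp only [(hN _).bimodule]
    exact ((h p).const_mul b).mul_const b'
  · exact CStarAlgebra.isClosed_nonneg.mem_of_tendsto (h _)
      (Eventually.of_forall fun N => (hN N).pos p)

variable [PartialOrder A] [StarOrderedRing A]

theorem isMomentSeries_momentFMS (P : BProbSpace B A) (m : ℕ) (x : A) :
    IsMomentSeries (P.law x) (P.momentFMS m x) :=
  ⟨rfl, fun n v => P.momentFMS_apply_law m x n.succ_ne_zero v⟩

variable {x : ℕ → A}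

theorem IsMonotoneIID.tendsto_momentFMS (hx : P.IsMonotoneIID x) (m n : ℕ) :
    Tendsto (fun N => P.momentFMS m (normalizedSum x N) n) atTop
      (𝓝 (compLimit (P.momentFMS m (x 0)) n)) := by
  have h := tendsto_compIter (P.momentFMS_one m (x 0)) (P.momentFMS_two (hx.centered 0) m) n
  refine h.congr fun N => ?_
  rw [normalizedSum, momentFMS_smul, hx.momentFMS_sum]
  rfl

theorem IsMonotoneIID.tendsto_polyWord (hx : P.IsMonotoneIID x) (m n : ℕ)
    (v : Fin (n + 1) → CStarMatrix (Fin m) (Fin m) B) (i j : Fin m) :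
    Tendsto (fun N => P.law (normalizedSum x N) (polyWord (List.ofFn v) i j)) atTop
      (𝓝 (compLimit (P.momentFMS m (x 0)) (n + 1) v i j)) := by
  have h1 : Tendsto (fun N => P.momentFMS m (normalizedSum x N) (n + 1) v) atTop
      (𝓝 (compLimit (P.momentFMS m (x 0)) (n + 1) v)) :=
    ((ContinuousMultilinearMap.apply ℂ _ _ v).continuous.tendsto _).comp
      (hx.tendsto_momentFMS m (n + 1))
  have h2 : Continuous fun M : CStarMatrix (Fin m) (Fin m) B => M i j :=
    (continuous_apply j).comp (continuous_apply (A := fun _ : Fin m => Fin m → B) i)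
  refine ((h2.tendsto _).comp h1).congr fun N => ?_
  rw [Function.comp_apply, (P.isMomentSeries_momentFMS m _).succ, map_apply]

/-- The monotone central limit theorem. -/
theorem IsMonotoneIID.exists_isArcsineLaw (hx : P.IsMonotoneIID x) :
    ∃ 𝔞 : NCPoly B →ₗ[ℂ] B, P.IsArcsineLaw x 𝔞 := by
  -- The polynomials on which the laws converge form a subspace, so it suffices to treat words.
  let S : Submodule ℂ (NCPoly B) :=
    { carrier := {f | ∃ b, Tendsto (fun N => P.law (normalizedSum x N) f) atTop (𝓝 b)}
      zero_mem' := ⟨0, by simp⟩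
      add_mem' := by
        rintro f g ⟨b, hb⟩ ⟨c, hc⟩
        exact ⟨b + c, by simpa using hb.add hc⟩
      smul_mem' := by
        rintro c f ⟨b, hb⟩
        exact ⟨c • b, by simpa using hb.const_smul c⟩ }
  have h : ∀ f, ∃ b, Tendsto (fun N => P.law (normalizedSum x N) f) atTop (𝓝 b) :=
    NCPoly.induction_polyWord (S := S) fun n v => ⟨_, hx.tendsto_polyWord 1 n v 0 0⟩
  choose a ha using h
  exact ⟨{ toFun := a
           map_add' := fun f g => tendsto_nhds_unique (ha (f + g)) (by
             simpa using (ha f).add (ha g))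
           map_smul' := fun c f => tendsto_nhds_unique (ha (c • f)) (by
             simpa using (ha f).const_smul c) }, ha⟩

theorem IsMonotoneIID.isMomentSeries_compLimit (hx : P.IsMonotoneIID x) {𝔞 : NCPoly B →ₗ[ℂ] B}
    (h𝔞 : P.IsArcsineLaw x 𝔞) (m : ℕ) :
    IsMomentSeries 𝔞 (compLimit (P.momentFMS m (x 0))) where
  zero := compLimit_zero
  succ n v := by
    ext i j
    exact tendsto_nhds_unique (hx.tendsto_polyWord m n v i j) (h𝔞 _)

/-- Convolution of two monotone independent variables with the same law. -/
theorem MonotoneIndep.law_add {P : BProbSpace B A} {y z : A} (h : P.MonotoneIndep ![y, z])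
    {μ : NCPoly B →ₗ[ℂ] B} (hy : P.law y = μ) (hz : P.law z = μ)
    {p : FormalMultilinearSeries ℂ (CStarMatrix (Fin 1) (Fin 1) B)
      (CStarMatrix (Fin 1) (Fin 1) B)} (hp : IsMomentSeries μ p)
    (hcomp : p.comp p = p.dil (Real.sqrt 2 : ℂ)) :
    P.law (y + z) = dilation (Real.sqrt 2) μ := by
  have hsum := P.isMomentSeries_momentFMS 1 (y + z)
  have hy' := P.isMomentSeries_momentFMS 1 y
  have hz' := P.isMomentSeries_momentFMS 1 z
  rw [hy] at hy'
  rw [hz] at hz'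
  have hadd : P.momentFMS 1 (y + z) = (P.momentFMS 1 y).comp (P.momentFMS 1 z) :=
    h.momentFMS_add 1 (Submodule.subset_span ⟨0, by simp, rfl⟩)
      (P.mem_genAlg ![y, z] (i := 1) Set.self_mem_Ici) 1
  rw [hadd, hy'.unique hp, hz'.unique hp, hcomp] at hsum
  exact hsum.eq_law (hp.dilation _)

end BProbSpace

end

theorem mainTheorem4 {B A : Type*} [CStarAlgebra B] [PartialOrder B] [StarOrderedRing B]
    [CStarAlgebra A] (P : BProbSpace B A) (x : ℕ → A) (hx : P.IsMonotoneIID x) :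
    ∃ 𝔞 : NCPoly B →ₗ[ℂ] B, IsBDistribution₀ 𝔞 ∧ P.IsArcsineLaw x 𝔞 ∧
      -- `𝔥_𝔞 ∘ 𝔥_𝔞 = 𝔥_{𝔞₂}` on the nilpotent matrices
      (∀ (m : ℕ), ∀ T ∈ nilp B m,
        hTransform 𝔞 T ∈ nilp B m ∧
        Summable (matMoment 𝔞 T) ∧
        Summable (matMoment 𝔞 (hTransform 𝔞 T)) ∧
        Summable (matMoment (dilation (Real.sqrt 2) 𝔞) T) ∧
        hTransform 𝔞 (hTransform 𝔞 T) = hTransform (dilation (Real.sqrt 2) 𝔞) T) ∧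
      -- the same identity on a ball around the origin, in matrices of every size
      (∃ r : ℝ, 0 < r ∧ ∀ (m : ℕ) (b : CStarMatrix (Fin m) (Fin m) B), ‖b‖ < r →
        Summable (matMoment 𝔞 b) ∧
        Summable (matMoment 𝔞 (hTransform 𝔞 b)) ∧
        Summable (matMoment (dilation (Real.sqrt 2) 𝔞) b) ∧
        hTransform 𝔞 (hTransform 𝔞 b) = hTransform (dilation (Real.sqrt 2) 𝔞) b) ∧
      -- the monotone convolution of `𝔞` with itself is `𝔞₂`
      (∀ (A' : Type*) [CStarAlgebra A'] (P' : BProbSpace B A') (y z : A'),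
        IsSelfAdjoint y → IsSelfAdjoint z → P'.law y = 𝔞 → P'.law z = 𝔞 →
        P'.MonotoneIndep ![y, z] → P'.law (y + z) = dilation (Real.sqrt 2) 𝔞) := by
  let _ := CStarAlgebra.spectralOrder A
  have := CStarAlgebra.spectralOrderedRing A
  obtain ⟨𝔞, h𝔞⟩ := hx.exists_isArcsineLaw
  have hdist := h𝔞.isBDistribution hx.selfAdjoint
  have hp := fun m => hx.isMomentSeries_compLimit h𝔞 m
  have hcomp := fun m => FormalMultilinearSeries.compLimit_comp_compLimit
    (P.momentFMS_one m (x 0)) (P.momentFMS_two (hx.centered 0) m)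
  -- The growth constant must satisfy `2‖x 0‖² ≤ M²`; the added `1` keeps it positive when `x 0 =
  -- 0`.
  have hM0 : 0 < 2 * ‖x 0‖ + 1 := by positivity
  have hM : ∀ m n, ‖FormalMultilinearSeries.compLimit (P.momentFMS m (x 0)) n‖ ≤
      (2 * ‖x 0‖ + 1) ^ (n - 1) := fun m n =>
    FormalMultilinearSeries.norm_compLimit_le (P.momentFMS_one m (x 0))
      (P.momentFMS_two (hx.centered 0) m) hM0.le
      (by nlinarith [P.norm_momentFMS_three_le m (x 0), norm_nonneg (x 0)]) n
  refine ⟨𝔞, ⟨hdist, exponentiallyBounded_of_isMomentSeries hM0 fun m => ⟨_, hp m, hM m⟩⟩, h𝔞,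
    ?_, ⟨(2 * (2 * ‖x 0‖ + 1))⁻¹, by positivity, fun m b hb =>
      (hp m).hTransform_hTransform hdist hM0 (hM m) (hcomp m) hb⟩, ?_⟩
  · rintro m T ⟨r, hT⟩
    have hT' := hTransform_map_ι_pow_eq_zero hdist.bimodule hT
    exact ⟨⟨r, hT'⟩, summable_matMoment_of_nilpotent _ hT, summable_matMoment_of_nilpotent _ hT',
      summable_matMoment_of_nilpotent _ hT,
      (hp m).hTransform_hTransform_of_nilpotent hdist hM0 (hM m) (hcomp m) hT⟩
  · intro A' _ P' y z _ _ hy hz hyz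
    let _ := CStarAlgebra.spectralOrder A'
    have := CStarAlgebra.spectralOrderedRing A'
    exact hyz.law_add hy hz (hp 1) (hcomp 1)
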